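/- Let $I\subseteq\mathbb R$ be an interval that is unbounded below (its left endpoint is $a=-\infty$), let $b:=\sup I$, and let $k,n$ be integers with $1\le k\le n+1$. *Classes of functions.* For a Borel function $f\colon I\to\mathbb R$ put $f^{(0)}:=f$, and recursively let $f^{(j+1)}$ be the function $g\colon I\to\mathbb R$ (if it exists, it is unique) that is right-continuous on $I\setminus\{b\}$, left-continuous at $b$ if $b\in I$, and satisfies $f^{(j)}(x)=f^{(j)}(z)+\int_z^x g(u)\,du$ for all $x,z\in I$. Let $\mathcal F_+^{k:n}$ be the set of all Borel functions $f\colon I\to\mathbb R$ such that $f^{(0)},\dots,f^{(n)}$ exist and $f^{(j)}$ is nondecreasing for each $j\in\{k-1,\dots,n\}$. For $t\in I$ and $x\in\mathbb R$ let $(x-t)_+^n$ equal $(x-t)^n$ if $x\ge t$ and $0$ if $x<t$; in particular, for $n=0$ it is the indicator of $\{x\ge t\}$. Let $\mathcal G$ be any set of functions such that $$\mathcal G\subseteq\mathcal F_+^{k:n},$$ every function in $\mathcal F_+^{k:n}$ that is the restriction to $I$ of a polynomial of degree $\le n$ belongs to $\mathcal G$, and for each $t\in I$ the function $I\ni x\mapsto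 (x-t)_+^n/n!$ belongs to $\mathcal G$. *Integrals.* For a nonnegative Borel measure $\nu$ and a Borel function $f$, the integral $\nu(f):=\nu(f_+)-\nu(f_-)\in[-\infty,\infty]$ is said to exist if $\nu(f_+)<\infty$ or $\nu(f_-)<\infty$; expectations are understood likewise, and every relation below between expectations includes the claim that they exist. A nonnegative Borel measure $\nu$ on $I$ is called admissible if for every $f\in\mathcal G$ the integral $\nu(f)$ exists and $\nu(f)>-\infty$. *Statement.* Let $X$ and $Y$ be random variables with values in $I$ (possibly defined on different probability spaces) whose distributions are admissible, and let $s$ and $z$ be any real numbers. Then $$\mathsf E f(X)\ge\mathsf E f(Y)\quad\text{for all }f\in\mathcal G$$ if and only if all of the following conditions hold: (i) $\mathsf E(X-s)^i=\mathsf E(Y-s)^i\in\mathbb R$ for all $i\in\{1,\dots,k-1\}$; (ii) if $k\le n$, then $\mathsf E(X-z)^k\ge\mathsf E(Y-z)^k$; (iii) $\mathsf E(X-t)_+^n\ge\mathsf E(Y-t)_+^n$ for all $t\in I$. -/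

import Mathlib

open MeasureTheory
open scoped ENNReal

noncomputable section

namespace MultMono

/-! ### Extended integrals -/

/-- The integral `ν(f)` exists in the extended sense: `ν(f₊) < ∞` or `ν(f₋) < ∞`. -/
def IntegralExists {α : Type*} [MeasurableSpace α] (ν : Measure α) (f : α → ℝ) : Prop :=
  (∫⁻ x, ENNReal.ofReal (f x) ∂ν) < ∞ ∨ (∫⁻ x, ENNReal.ofReal (-f x) ∂ν) < ∞

/-- `ν(f) = ν(f₊) - ν(f₋)` in `[-∞, ∞]`; meaningful only if `IntegralExists ν f`. -/
def extIntegral {α : Type*} [MeasurableSpace α] (ν : Measure α) (f : α → ℝ) : EReal :=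
  ((∫⁻ x, ENNReal.ofReal (f x) ∂ν : ℝ≥0∞) : EReal)
    - ((∫⁻ x, ENNReal.ofReal (-f x) ∂ν : ℝ≥0∞) : EReal)

/-- `μ(f)` and `ν(g)` both exist in `[-∞, ∞]`, and `μ(f) ≥ ν(g)`. -/
def IntegralGE {α β : Type*} [MeasurableSpace α] [MeasurableSpace β]
    (μ : Measure α) (f : α → ℝ) (ν : Measure β) (g : β → ℝ) : Prop :=
  IntegralExists μ f ∧ IntegralExists ν g ∧ extIntegral μ f ≥ extIntegral ν g

/-- `μ(f)` and `ν(g)` both exist, and `μ(f) = ν(g) ∈ ℝ`. -/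
def IntegralEqReal {α β : Type*} [MeasurableSpace α] [MeasurableSpace β]
    (μ : Measure α) (f : α → ℝ) (ν : Measure β) (g : β → ℝ) : Prop :=
  IntegralExists μ f ∧ IntegralExists ν g ∧
    ∃ m : ℝ, extIntegral μ f = (m : EReal) ∧ extIntegral ν g = (m : EReal)

/-! ### Multiply monotone functions on an interval -/

/-- Right-continuous at every point of `I` other than its right endpoint, and left-continuous at
the right endpoint if that belongs to `I`. -/
def IsLD (I : Set ℝ) (g : I → ℝ) : Prop :=
  ∀ x : I, ((∃ y : I, x < y) → ContinuousWithinAt g (Set.Ici x) x) ∧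
    ((∀ y : I, y ≤ x) → ContinuousWithinAt g (Set.Iic x) x)

/-- Extension by zero of a function on `I`, used only to write integrals over subintervals
of `I`. -/
def extendZero (I : Set ℝ) (g : I → ℝ) : ℝ → ℝ :=
  Function.extend Subtype.val g 0

/-- `g` is the generalized derivative of `f` on `I`: `g` is in the class `IsLD`, and
`f x = f z + ∫_z^x g` for all `x, z ∈ I` (the integral being a convergent one). -/
structure IsGenDeriv (I : Set ℝ) (f g : I → ℝ) : Prop where
  isLD : IsLD I g
  intervalIntegrable : ∀ z x : I, IntervalIntegrable (extendZero I g) volume z x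
  eq_add_integral : ∀ z x : I, f x = f z + ∫ u in (z : ℝ)..(x : ℝ), extendZero I g u

/-- `g` is the `j`-th generalized derivative `f^(j)` of the Borel function `f` on `I`. -/
def IsIterGenDeriv (I : Set ℝ) : ℕ → (I → ℝ) → (I → ℝ) → Prop
  | 0, f, g => Measurable f ∧ g = f
  | j + 1, f, g => ∃ h : I → ℝ, IsIterGenDeriv I j f h ∧ IsGenDeriv I h g

/-- The class of functions on `I` that have generalized derivatives up to the order `n`:
for `n = 0` all Borel functions; for `n ≥ 1` the `(n-1)`-times differentiable functions with an
absolutely continuous `(n-1)`-st derivative whose a.e. derivative is in the class `IsLD`. -/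
def genDiffClass (I : Set ℝ) (n : ℕ) : Set (I → ℝ) :=
  {f | ∃ g : I → ℝ, IsIterGenDeriv I n f g}

/-- The cone `F_+^{k:n}(I)`: functions `f` in `genDiffClass I n` such that `f^(j)` is nondecreasing
for each `j` with `k - 1 ≤ j ≤ n`. -/
def monoCone (I : Set ℝ) (k n : ℕ) : Set (I → ℝ) :=
  {f | f ∈ genDiffClass I n ∧
    ∀ j : ℕ, k ≤ j + 1 → j ≤ n → ∃ g : I → ℝ, IsIterGenDeriv I j f g ∧ Monotone g}

/-- Restrictions to `I` of polynomials of degree at most `n`. -/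
def polyClass (I : Set ℝ) (n : ℕ) : Set (I → ℝ) :=
  {f | ∃ p : Polynomial ℝ, p.natDegree ≤ n ∧ ∀ x : I, f x = p.eval (x : ℝ)}

/-- `u_+^n`, equal to `u^n` for `u ≥ 0` and to `0` for `u < 0`; so `u_+^0` is the indicator
of `u ≥ 0`. -/
def posPow (u : ℝ) (n : ℕ) : ℝ :=
  if 0 ≤ u then u ^ n else 0

/-- The truncated powers `x ↦ (x - t)_+^n / n!` on `I`, with `t ∈ I`. -/
def truncPowers (I : Set ℝ) (n : ℕ) : Set (I → ℝ) :=
  {f | ∃ t : I, ∀ x : I, f x = posPow ((x : ℝ) - t) n / (n.factorial : ℝ)}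

/-- The admissible set: nonnegative Borel measures `ν` on `I` such that `ν(f)` exists and is
greater than `-∞`, for all `f ∈ G`. -/
def admissible (I : Set ℝ) (G : Set (I → ℝ)) : Set (Measure I) :=
  {ν | ∀ f ∈ G, IntegralExists ν f ∧ extIntegral ν f > ⊥}

end MultMono

end

/-! ### Stochastic dominance for measures on the line -/

namespace MultMono

/-! Put m = k - 1. Necessity is a matter of test functions. A polynomial of degree below k lies in G
together with its negative, so its two expectations are finite and equal; (x - z)^k lies in G when k
≤ n; truncated powers lie in G by assumption.

For sufficiency, expand f at a point s of I: f is a polynomial of degree ≤ m plus the m-fold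
primitive from s of f^(m) - f^(m)(s). If m < n, then, I being unbounded below, monotonicity forces
f^(m+1) ≥ 0 with a limit L ≥ 0 at -∞, and the derivatives of order above m + 1 tend to 0 there.
Splitting off the slope L (L = 0 if m = n) gives f = p + L (x - s)^(m+1)/(m+1)! + R. Condition (i)
settles p, condition (ii) settles the power, and R remains.

Replace f^(n) by its increment (f^(n) - f^(n)(c))_+ beyond c. The n-fold primitive from -∞ of this
increment is morally a mixture of truncated powers, so (iii) compares its expectations. The proof is
`lintegral_lprim_iterate_le`: Tonelli moves each primitive from the function to the measure, which
becomes the measure with density μ(u, ∞), until only ordinary stochastic dominance is left. Up to a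
polynomial of degree ≤ m, this n-fold primitive is an approximation R'_c of R (`exists_truncation`).

Both R'_c and R - R'_c are m-fold primitives from s of nondecreasing functions vanishing at s, so at
each point they have the same sign. Hence the positive and negative parts of R'_c lie below those of
R, and the expectations converge as c → -∞ even if infinite. The power has that same sign too, so
the negative part of R is bounded by that of f - p, and the expectation of f splits without ∞ - ∞.
-/

theorem measure_Ioi_le_of_Ici {μ ν : Measure ℝ} (h : ∀ t, ν (Set.Ici t) ≤ μ (Set.Ici t)) (a : ℝ) :
    ν (Set.Ioi a) ≤ μ (Set.Ioi a) := by
  obtain ⟨u, hu, hua, hlim⟩ := exists_seq_strictAnti_tendsto a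
  have hU : Set.Ioi a = ⋃ i, Set.Ici (u i) := by
    ext x
    simp only [Set.mem_Ioi, Set.mem_iUnion, Set.mem_Ici]
    constructor
    · intro hx
      obtain ⟨i, hi⟩ := (hlim.eventually (gt_mem_nhds hx)).exists
      exact ⟨i, hi.le⟩
    · rintro ⟨i, hi⟩
      exact (hua i).trans_le hi
  have hmono : Monotone fun i => Set.Ici (u i) := fun i j hij =>
    Set.Ici_subset_Ici.2 (hu.antitone hij)
  rw [hU, hmono.measure_iUnion, hmono.measure_iUnion]
  exact iSup_mono fun i => h (u i)

/-- Such a set is a half-line, closed or open according to whether it contains its infimum; the open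
one is an increasing union of closed ones. -/
theorem measure_upperSet_le {μ ν : Measure ℝ} (h : ∀ t, ν (Set.Ici t) ≤ μ (Set.Ici t))
    {U : Set ℝ} (hU : IsUpperSet U) (hb : BddBelow U) : ν U ≤ μ U := by
  rcases U.eq_empty_or_nonempty with rfl | hne
  · simp
  by_cases hm : sInf U ∈ U
  · have : U = Set.Ici (sInf U) :=
      Set.Subset.antisymm (fun x hx => csInf_le hb hx) fun x hx => hU hx hm
    rw [this]
    exact h _
  · have : U = Set.Ioi (sInf U) := by
      refine Set.Subset.antisymm (fun x hx => lt_of_le_of_ne (csInf_le hb hx) ?_) fun x hx => ?_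
      · rintro rfl
        exact hm hx
      · obtain ⟨y, hy, hyx⟩ := exists_lt_of_csInf_lt hne hx
        exact hU hyx.le hy
    rw [this]
    exact measure_Ioi_le_of_Ici h _

theorem lintegral_indicator_ofReal_lt (y : ℝ≥0∞) :
    ∫⁻ t in Set.Ioi (0 : ℝ), {t : ℝ | ENNReal.ofReal t < y}.indicator 1 t = y := by
  have hms : MeasurableSet {t : ℝ | ENNReal.ofReal t < y} :=
    measurableSet_lt ENNReal.measurable_ofReal measurable_const
  rw [lintegral_indicator_one hms, Measure.restrict_apply hms]
  induction y with
  | top =>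
    have : {t : ℝ | ENNReal.ofReal t < ⊤} ∩ Set.Ioi (0 : ℝ) = Set.Ioi 0 := by
      ext t; simp
    rw [this, Real.volume_Ioi]
  | coe r =>
    have : {t : ℝ | ENNReal.ofReal t < (r : ℝ≥0∞)} ∩ Set.Ioi (0 : ℝ) = Set.Ioo 0 (r : ℝ) := by
      ext t
      simp only [Set.mem_inter_iff, Set.mem_ofPred_eq, Set.mem_Ioi, Set.mem_Ioo]
      constructor
      · rintro ⟨h1, h2⟩
        refine ⟨h2, ?_⟩
        rw [← ENNReal.ofReal_coe_nnreal] at h1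
        exact (ENNReal.ofReal_lt_ofReal_iff_of_nonneg h2.le).1 h1
      · rintro ⟨h1, h2⟩
        refine ⟨?_, h1⟩
        rw [← ENNReal.ofReal_coe_nnreal]
        exact (ENNReal.ofReal_lt_ofReal_iff_of_nonneg h1.le).2 h2
    rw [this, Real.volume_Ioo]
    simp

/-- Layer-cake formula by Tonelli: y is the length of {t > 0 : t < y}. It covers y = ∞, a value that
the extensions beyond I will take. -/
theorem lintegral_eq_lintegral_superlevel (μ : Measure ℝ) [SFinite μ] {g : ℝ → ℝ≥0∞}
    (hg : Measurable g) :
    ∫⁻ x, g x ∂μ = ∫⁻ t in Set.Ioi (0 : ℝ), μ {x | ENNReal.ofReal t < g x} := by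
  have hms : MeasurableSet {q : ℝ × ℝ | ENNReal.ofReal q.2 < g q.1} :=
    measurableSet_lt (ENNReal.measurable_ofReal.comp measurable_snd) (hg.comp measurable_fst)
  calc ∫⁻ x, g x ∂μ
      = ∫⁻ x, ∫⁻ t in Set.Ioi (0 : ℝ), {t : ℝ | ENNReal.ofReal t < g x}.indicator 1 t ∂volume ∂μ := by
        exact lintegral_congr fun x => (lintegral_indicator_ofReal_lt (g x)).symm
    _ = ∫⁻ x, ∫⁻ t in Set.Ioi (0 : ℝ),
          {q : ℝ × ℝ | ENNReal.ofReal q.2 < g q.1}.indicator 1 (x, t) ∂volume ∂μ := rfl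
    _ = ∫⁻ t in Set.Ioi (0 : ℝ), ∫⁻ x,
          {q : ℝ × ℝ | ENNReal.ofReal q.2 < g q.1}.indicator 1 (x, t) ∂μ :=
        lintegral_lintegral_swap (f := fun x t =>
            {q : ℝ × ℝ | ENNReal.ofReal q.2 < g q.1}.indicator 1 (x, t))
          (measurable_one.indicator hms).aemeasurable
    _ = ∫⁻ t in Set.Ioi (0 : ℝ), μ {x | ENNReal.ofReal t < g x} := by
        refine lintegral_congr fun t => ?_
        rw [← lintegral_indicator_one (measurableSet_lt measurable_const hg)]
        rfl

theorem lintegral_le_of_tails {μ ν : Measure ℝ} [SFinite μ] [SFinite ν]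
    (h : ∀ t, ν (Set.Ici t) ≤ μ (Set.Ici t)) {g : ℝ → ℝ≥0∞} (hg : Monotone g) {c : ℝ}
    (hc : g c = 0) : ∫⁻ x, g x ∂ν ≤ ∫⁻ x, g x ∂μ := by
  rw [lintegral_eq_lintegral_superlevel μ hg.measurable,
    lintegral_eq_lintegral_superlevel ν hg.measurable]
  refine lintegral_mono fun t => measure_upperSet_le h ?_ ⟨c, ?_⟩
  · exact fun x y hxy hx => lt_of_lt_of_le hx (hg hxy)
  · intro x hx
    by_contra hlt
    have := hg (le_of_not_ge hlt)
    rw [hc] at this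
    exact not_lt_bot (lt_of_lt_of_le hx this)

/-! ### Primitives from `-∞` and tail measures -/

/-- The primitive from `-∞`, for extended nonnegative functions. -/
noncomputable def lprim (g : ℝ → ℝ≥0∞) (x : ℝ) : ℝ≥0∞ := ∫⁻ u in Set.Iio x, g u

theorem lprim_mono (g : ℝ → ℝ≥0∞) : Monotone (lprim g) := fun _ _ hxy =>
  lintegral_mono_set (Set.Iio_subset_Iio hxy)

theorem lprim_iterate_mono {g : ℝ → ℝ≥0∞} (hg : Monotone g) (n : ℕ) : Monotone (lprim^[n] g) := by
  cases n with
  | zero => exact hg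
  | succ n =>
    rw [Function.iterate_succ_apply']
    exact lprim_mono _

/-- The measure with density equal to the tail of `μ`. -/
noncomputable def tailMeasure (μ : Measure ℝ) : Measure ℝ :=
  volume.withDensity fun u => μ (Set.Ioi u)

instance (μ : Measure ℝ) : SFinite (tailMeasure μ) := by
  unfold tailMeasure; infer_instance

/-- Tonelli on the region u < x. -/
theorem lintegral_tailMeasure (μ : Measure ℝ) [SFinite μ] {g : ℝ → ℝ≥0∞} (hg : Measurable g) :
    ∫⁻ u, g u ∂(tailMeasure μ) = ∫⁻ x, lprim g x ∂μ := by
  have hanti : Antitone fun u => μ (Set.Ioi u) := fun _ _ hxy =>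
    measure_mono (Set.Ioi_subset_Ioi hxy)
  have hms : MeasurableSet {q : ℝ × ℝ | q.2 < q.1} := measurableSet_lt measurable_snd measurable_fst
  rw [tailMeasure, lintegral_withDensity_eq_lintegral_mul _ hanti.measurable hg]
  symm
  calc ∫⁻ x, lprim g x ∂μ
      = ∫⁻ x, ∫⁻ u, {q : ℝ × ℝ | q.2 < q.1}.indicator (fun q => g q.2) (x, u) ∂volume ∂μ := by
        refine lintegral_congr fun x => ?_
        rw [lprim, ← lintegral_indicator measurableSet_Iio]
        rfl
    _ = ∫⁻ u, ∫⁻ x, {q : ℝ × ℝ | q.2 < q.1}.indicator (fun q => g q.2) (x, u) ∂μ ∂volume :=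
        lintegral_lintegral_swap (f := fun x u =>
            {q : ℝ × ℝ | q.2 < q.1}.indicator (fun q => g q.2) (x, u))
          ((hg.comp measurable_snd).indicator hms).aemeasurable
    _ = _ := by
        refine lintegral_congr fun u => ?_
        have : (fun x => {q : ℝ × ℝ | q.2 < q.1}.indicator (fun q => g q.2) (x, u))
            = (Set.Ioi u).indicator fun _ => g u := rfl
        rw [this, lintegral_indicator_const measurableSet_Ioi, Pi.mul_apply, mul_comm]

theorem measurable_posPow (n : ℕ) (t : ℝ) : Measurable fun x : ℝ => posPow (x - t) n := by
  unfold posPow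
  exact Measurable.ite (measurableSet_le measurable_const (by fun_prop)) (by fun_prop) (by fun_prop)

theorem posPow_nonneg (u : ℝ) (n : ℕ) : 0 ≤ posPow u n := by
  unfold posPow; split_ifs with h
  · positivity
  · exact le_rfl

theorem lprim_posPow (n : ℕ) (t x : ℝ) :
    lprim (fun u => ENNReal.ofReal (posPow (u - t) n / n.factorial)) x =
      ENNReal.ofReal (posPow (x - t) (n + 1) / (n + 1).factorial) := by
  have hz : ∀ u, u < t → ENNReal.ofReal (posPow (u - t) n / n.factorial) = 0 := by
    intro u hu
    simp [posPow, not_le.2 hu]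
  unfold lprim
  rcases le_or_gt t x with htx | htx
  · have h1 : ∫⁻ u in Set.Iio x, ENNReal.ofReal (posPow (u - t) n / n.factorial)
        = ∫⁻ u in Set.Ioc t x, ENNReal.ofReal ((u - t) ^ n / n.factorial) := by
      rw [← lintegral_indicator measurableSet_Iio, ← lintegral_indicator measurableSet_Ioc]
      refine lintegral_congr_ae ?_
      -- The integrands may differ at the endpoints; for n = 0 the truncated power is already 1 at
      -- t.
      filter_upwards [Measure.ae_ne volume t, Measure.ae_ne volume x] with u hut hux
      by_cases h1 : u < x
      · by_cases h2 : t < u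
        · simp [Set.indicator, h1, h2, h1.le, posPow, h2.le]
        · have : u < t := lt_of_le_of_ne (not_lt.1 h2) hut
          simp [Set.indicator, h1, h2, hz u this]
      · have : ¬ u ≤ x := fun h => h1 (lt_of_le_of_ne h hux)
        simp [Set.indicator, h1, this]
    have hint : IntervalIntegrable (fun u : ℝ => (u - t) ^ n / n.factorial) volume t x :=
      (by fun_prop : Continuous fun u : ℝ => (u - t) ^ n / n.factorial).intervalIntegrable _ _
    rw [h1, ← ofReal_integral_eq_lintegral_ofReal hint.1
      ((ae_restrict_mem measurableSet_Ioc).mono fun u hu =>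
        div_nonneg (pow_nonneg (sub_nonneg.2 hu.1.le) _) (Nat.cast_nonneg _)),
      ← intervalIntegral.integral_of_le htx, intervalIntegral.integral_div,
      intervalIntegral.integral_comp_sub_right (fun u => u ^ n), integral_pow]
    congr 1
    simp only [posPow, sub_nonneg, htx, if_true, sub_self, Nat.factorial_succ, Nat.cast_mul]
    push_cast
    field_simp
    simp
  · have : posPow (x - t) (n + 1) = 0 := by simp [posPow, not_le.2 htx]
    rw [this, setLIntegral_congr_fun measurableSet_Iio (fun u hu => hz u (lt_trans hu htx))]
    simp

/-- By `lprim_posPow`, the hypothesis for n + 1 is the hypothesis for n on the tail measures. These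
can be infinite, which is why only s-finiteness is assumed. -/
theorem lintegral_lprim_iterate_le (n : ℕ) {μ ν : Measure ℝ} [SFinite μ] [SFinite ν]
    (h : ∀ t : ℝ, ∫⁻ x, ENNReal.ofReal (posPow (x - t) n / n.factorial) ∂ν ≤
      ∫⁻ x, ENNReal.ofReal (posPow (x - t) n / n.factorial) ∂μ)
    {g : ℝ → ℝ≥0∞} (hg : Monotone g) {c : ℝ} (hc : g c = 0) :
    ∫⁻ x, lprim^[n] g x ∂ν ≤ ∫⁻ x, lprim^[n] g x ∂μ := by
  induction n generalizing μ ν with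
  | zero =>
    refine lintegral_le_of_tails (fun t => ?_) hg hc
    have key : ∀ ρ : Measure ℝ,
        ∫⁻ x, ENNReal.ofReal (posPow (x - t) 0 / (Nat.factorial 0 : ℕ)) ∂ρ = ρ (Set.Ici t) := by
      intro ρ
      rw [← lintegral_indicator_one measurableSet_Ici]
      refine lintegral_congr fun x => ?_
      by_cases hx : t ≤ x <;> simp [posPow, Set.indicator, hx]
    have := h t
    rwa [key, key] at this
  | succ n ih =>
    have hm := (lprim_iterate_mono hg n).measurable
    rw [Function.iterate_succ_apply', ← lintegral_tailMeasure μ hm, ← lintegral_tailMeasure ν hm]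
    refine ih fun t => ?_
    have hp : Measurable fun x : ℝ => ENNReal.ofReal (posPow (x - t) n / n.factorial) :=
      ((measurable_posPow n t).div_const _).ennreal_ofReal
    rw [lintegral_tailMeasure μ hp, lintegral_tailMeasure ν hp]
    simp_rw [lprim_posPow]
    exact h t

/-! ### Iterated primitives from a base point, Taylor's formula, truncation -/

/-- The primitive of `h` vanishing at `c`. -/
noncomputable def prim (c : ℝ) (h : ℝ → ℝ) (x : ℝ) : ℝ := ∫ u in c..x, h u

/-- Integrability over compact subintervals of `I`. -/
def LocInt (I : Set ℝ) (h : ℝ → ℝ) : Prop :=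
  ∀ a ∈ I, ∀ b ∈ I, IntervalIntegrable h volume a b

theorem LocInt.sub {I : Set ℝ} {g h : ℝ → ℝ} (hg : LocInt I g) (hh : LocInt I h) :
    LocInt I (fun u => g u - h u) := fun a ha b hb => (hg a ha b hb).sub (hh a ha b hb)

theorem _root_.Continuous.locInt {I : Set ℝ} {h : ℝ → ℝ} (hh : Continuous h) : LocInt I h :=
  fun a _ b _ => hh.intervalIntegrable a b

section

variable {I : Set ℝ}

theorem locInt_of_monotoneOn (hI : I.OrdConnected) {h : ℝ → ℝ} (hh : MonotoneOn h I) :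
    LocInt I h := fun _ ha _ hb => (hh.mono (hI.uIcc_subset ha hb)).intervalIntegrable

theorem prim_sub_prim {c : ℝ} (hc : c ∈ I) {h : ℝ → ℝ} (hh : LocInt I h) {x z : ℝ} (hx : x ∈ I)
    (hz : z ∈ I) : prim c h x = prim c h z + ∫ u in z..x, h u :=
  (intervalIntegral.integral_add_adjacent_intervals (hh c hc z hz) (hh z hz x hx)).symm

theorem locInt_prim (hI : I.OrdConnected) {c : ℝ} (hc : c ∈ I) {h : ℝ → ℝ} (hh : LocInt I h) :
    LocInt I (prim c h) := by
  intro a ha b hb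
  have h1 : ContinuousOn (fun x => prim c h a + ∫ u in a..x, h u) (Set.uIcc a b) :=
    continuousOn_const.add
      (intervalIntegral.continuousOn_primitive_interval' (hh a ha b hb) Set.left_mem_uIcc)
  refine (h1.congr fun x hx => ?_).intervalIntegrable
  exact prim_sub_prim hc hh (hI.uIcc_subset ha hb hx) ha

theorem locInt_prim_iterate (hI : I.OrdConnected) {c : ℝ} (hc : c ∈ I) {h : ℝ → ℝ}
    (hh : LocInt I h) (m : ℕ) : LocInt I ((prim c)^[m] h) := by
  induction m with
  | zero => exact hh
  | succ m ih => rw [Function.iterate_succ_apply']; exact locInt_prim hI hc ih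

theorem prim_iterate_congr (hI : I.OrdConnected) {s : ℝ} (hs : s ∈ I) {g h : ℝ → ℝ}
    (hgh : Set.EqOn g h I) (m : ℕ) : Set.EqOn ((prim s)^[m] g) ((prim s)^[m] h) I := by
  induction m with
  | zero => exact hgh
  | succ m ih =>
    intro x hx
    simp only [Function.iterate_succ_apply']
    exact intervalIntegral.integral_congr fun u hu => ih (hI.uIcc_subset hs hx hu)

theorem prim_iterate_add (hI : I.OrdConnected) {s : ℝ} (hs : s ∈ I) {g h : ℝ → ℝ}
    (hg : LocInt I g) (hh : LocInt I h) (m : ℕ) {x : ℝ} (hx : x ∈ I) :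
    (prim s)^[m] (fun u => g u + h u) x = (prim s)^[m] g x + (prim s)^[m] h x := by
  induction m generalizing x with
  | zero => rfl
  | succ m ih =>
    simp only [Function.iterate_succ_apply']
    have : prim s ((prim s)^[m] fun u => g u + h u) x
        = ∫ u in s..x, ((prim s)^[m] g u + (prim s)^[m] h u) :=
      intervalIntegral.integral_congr fun u hu => ih (hI.uIcc_subset hs hx hu)
    rw [this]
    exact intervalIntegral.integral_add (locInt_prim_iterate hI hs hg m s hs x hx)
      (locInt_prim_iterate hI hs hh m s hs x hx)

theorem prim_iterate_linear (s a : ℝ) (m : ℕ) (x : ℝ) :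
    (prim s)^[m] (fun u => a * (u - s)) x = a * (x - s) ^ (m + 1) / (m + 1).factorial := by
  induction m generalizing x with
  | zero => simp
  | succ m ih =>
    rw [Function.iterate_succ_apply']
    unfold prim at ih ⊢
    simp_rw [ih]
    rw [intervalIntegral.integral_div, intervalIntegral.integral_const_mul,
      intervalIntegral.integral_comp_sub_right (fun u => u ^ (m + 1)), integral_pow,
      Nat.factorial_succ (m + 1)]
    push_cast
    field_simp
    simp

theorem prim_iterate_nonneg_right (hI : I.OrdConnected) {s : ℝ} (hs : s ∈ I) {h : ℝ → ℝ}
    (hh : ∀ u ∈ I, s ≤ u → 0 ≤ h u) (m : ℕ) {x : ℝ} (hx : x ∈ I) (hsx : s ≤ x) :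
    0 ≤ (prim s)^[m] h x := by
  induction m generalizing x with
  | zero => exact hh x hx hsx
  | succ m ih =>
    rw [Function.iterate_succ_apply']
    exact intervalIntegral.integral_nonneg hsx fun u hu => ih (hI.out hs hx hu) hu.1

/-- Integrating from s towards the left reverses the sign each time. -/
theorem prim_iterate_sign_left (hI : I.OrdConnected) {s : ℝ} (hs : s ∈ I) {h : ℝ → ℝ}
    (hh : ∀ u ∈ I, u ≤ s → h u ≤ 0) (m : ℕ) {x : ℝ} (hx : x ∈ I) (hxs : x ≤ s) :
    0 ≤ (-1) ^ (m + 1) * (prim s)^[m] h x := by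
  induction m generalizing x with
  | zero => simpa using hh x hx hxs
  | succ m ih =>
    rw [Function.iterate_succ_apply', prim, intervalIntegral.integral_symm, pow_succ, mul_assoc,
      neg_one_mul, neg_neg, ← intervalIntegral.integral_const_mul]
    exact intervalIntegral.integral_nonneg hxs fun u hu => ih (hI.out hx hs hu) hu.2

/-- The iterated primitives from `s` of nondecreasing functions vanishing at `s` all have the same
sign at a given point. -/
theorem exists_sign_prim_iterate (hI : I.OrdConnected) {s : ℝ} (hs : s ∈ I) (m : ℕ) {x : ℝ}
    (hx : x ∈ I) : ∃ ε : ℝ, (ε = 1 ∨ ε = -1) ∧ ∀ h : ℝ → ℝ, MonotoneOn h I → h s = 0 →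
      0 ≤ ε * (prim s)^[m] h x := by
  rcases le_total s x with hsx | hxs
  · refine ⟨1, Or.inl rfl, fun h hh h0 => ?_⟩
    rw [one_mul]
    exact prim_iterate_nonneg_right hI hs (fun u hu hsu => h0 ▸ hh hs hu hsu) m hx hsx
  · refine ⟨(-1) ^ (m + 1), neg_one_pow_eq_or ℝ _, fun h hh h0 => ?_⟩
    exact prim_iterate_sign_left hI hs (fun u hu hus => h0 ▸ hh hu hs hus) m hx hxs

theorem abs_prim_iterate_le {s x C : ℝ} {h : ℝ → ℝ} (hh : ∀ u ∈ Set.uIcc s x, |h u| ≤ C) (m : ℕ)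
    {y : ℝ} (hy : y ∈ Set.uIcc s x) : |(prim s)^[m] h y| ≤ C * |x - s| ^ m := by
  induction m generalizing y with
  | zero => simpa using hh y hy
  | succ m ih =>
    rw [Function.iterate_succ_apply', pow_succ, ← mul_assoc]
    have hC : 0 ≤ C := (abs_nonneg _).trans (hh s Set.left_mem_uIcc)
    have h1 : ∀ u ∈ Set.uIoc s y, ‖(prim s)^[m] h u‖ ≤ C * |x - s| ^ m := fun u hu =>
      ih (Set.uIcc_subset_uIcc_left hy (Set.uIoc_subset_uIcc hu))
    exact (intervalIntegral.norm_integral_le_of_norm_le_const h1).trans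
      (mul_le_mul_of_nonneg_left (Set.abs_sub_left_of_mem_uIcc hy) (by positivity))

/-- `D (j + 1)` is a derivative of `D j` on `I`, for `j < n`. -/
def IsChain (I : Set ℝ) (D : ℕ → ℝ → ℝ) (n : ℕ) : Prop :=
  ∀ j < n, LocInt I (D (j + 1)) ∧
    ∀ z ∈ I, ∀ x ∈ I, D j x = D j z + ∫ u in z..x, D (j + 1) u

theorem IsChain.of_le {D : ℕ → ℝ → ℝ} {m n : ℕ} (hD : IsChain I D n) (hmn : m ≤ n) :
    IsChain I D m := fun j hj => hD j (hj.trans_le hmn)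

theorem IsChain.exists_taylor (hI : I.OrdConnected) {s : ℝ} (hs : s ∈ I) {D : ℕ → ℝ → ℝ} {m : ℕ}
    (hD : IsChain I D m) : ∃ p : Polynomial ℝ, p.natDegree ≤ m ∧ ∀ x ∈ I,
      D 0 x = p.eval x + (prim s)^[m] (fun u => D m u - D m s) x := by
  induction m with
  | zero => exact ⟨Polynomial.C (D 0 s), by simp, fun x _ => by simp⟩
  | succ m ih =>
    obtain ⟨p, hp, hpx⟩ := ih (hD.of_le m.le_succ)
    obtain ⟨hloc, hint⟩ := hD m m.lt_succ_self
    refine ⟨p + Polynomial.C (D (m + 1) s / (m + 1).factorial) *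
      (Polynomial.X - Polynomial.C s) ^ (m + 1), ?_, fun x hx => ?_⟩
    · refine (Polynomial.natDegree_add_le _ _).trans (max_le (hp.trans m.le_succ) ?_)
      refine (Polynomial.natDegree_C_mul_le _ _).trans ?_
      rw [Polynomial.natDegree_pow, Polynomial.natDegree_X_sub_C, mul_one]
    · have h2 : LocInt I fun u => D (m + 1) u - D (m + 1) s :=
        hloc.sub (continuous_const.locInt)
      -- The linear term, integrated m more times, is the next Taylor monomial; the rest is the new
      -- remainder.
      have h1 : Set.EqOn (fun u => D m u - D m s)
          (fun u => prim s (fun v => D (m + 1) v - D (m + 1) s) u + D (m + 1) s * (u - s)) I := by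
        intro u hu
        have : prim s (fun v => D (m + 1) v - D (m + 1) s) u
            = (∫ v in s..u, D (m + 1) v) - D (m + 1) s * (u - s) := by
          rw [prim, intervalIntegral.integral_sub (hloc s hs u hu) (by simp)]
          simp [mul_comm]
        simp only [this]
        rw [hint s hs u hu]
        ring
      rw [hpx x hx, prim_iterate_congr hI hs h1 m hx,
        prim_iterate_add hI hs (locInt_prim hI hs h2)
          ((by fun_prop : Continuous fun u => D (m + 1) s * (u - s)).locInt) m hx,
        prim_iterate_linear, Function.iterate_succ_apply]
      simp only [Polynomial.eval_add, Polynomial.eval_mul, Polynomial.eval_C, Polynomial.eval_pow,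
        Polynomial.eval_sub, Polynomial.eval_X]
      ring

/-- The increment of `d` from the point `c` on. -/
def cut (d : ℝ → ℝ) (c u : ℝ) : ℝ := max (d u - d c) 0

theorem cut_monotoneOn {d : ℝ → ℝ} (hd : MonotoneOn d I) (c : ℝ) : MonotoneOn (cut d c) I :=
  fun _ hx _ hy hxy => max_le_max (sub_le_sub_right (hd hx hy hxy) _) le_rfl

theorem cut_eq_zero {d : ℝ → ℝ} (hd : MonotoneOn d I) {c u : ℝ} (hc : c ∈ I) (hu : u ∈ I)
    (huc : u ≤ c) : cut d c u = 0 := max_eq_right (sub_nonpos.2 (hd hu hc huc))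

theorem prim_iterate_cut_eq_zero (hI : I.OrdConnected) {d : ℝ → ℝ} (hd : MonotoneOn d I) {c : ℝ}
    (hc : c ∈ I) (i : ℕ) {u : ℝ} (hu : u ∈ I) (huc : u ≤ c) : (prim c)^[i] (cut d c) u = 0 := by
  induction i generalizing u with
  | zero => exact cut_eq_zero hd hc hu huc
  | succ i ih =>
    rw [Function.iterate_succ_apply', prim,
      intervalIntegral.integral_congr (g := fun _ => 0) fun v hv => ?_]
    · simp
    · rw [Set.uIcc_of_ge huc] at hv
      exact ih (hI.out hu hc hv) hv.2

theorem prim_iterate_cut_nonneg (hI : I.OrdConnected) {d : ℝ → ℝ} (hd : MonotoneOn d I) {c : ℝ}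
    (hc : c ∈ I) (i : ℕ) {u : ℝ} (hu : u ∈ I) : 0 ≤ (prim c)^[i] (cut d c) u := by
  rcases le_total c u with h | h
  · exact prim_iterate_nonneg_right hI hc (fun v _ _ => le_max_right _ _) i hu h
  · exact (prim_iterate_cut_eq_zero hI hd hc i hu h).ge

theorem locInt_cut (hI : I.OrdConnected) {d : ℝ → ℝ} (hd : MonotoneOn d I) {c : ℝ}
    (hc : c ∈ I) (i : ℕ) : LocInt I ((prim c)^[i] (cut d c)) :=
  locInt_prim_iterate hI hc (locInt_of_monotoneOn hI (cut_monotoneOn hd c)) i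

theorem prim_iterate_succ_cut (hI : I.OrdConnected) {d : ℝ → ℝ} (hd : MonotoneOn d I) {c : ℝ}
    (hc : c ∈ I) (i : ℕ) {x z : ℝ} (hx : x ∈ I) (hz : z ∈ I) :
    (prim c)^[i + 1] (cut d c) x =
      (prim c)^[i + 1] (cut d c) z + ∫ u in z..x, (prim c)^[i] (cut d c) u := by
  rw [Function.iterate_succ_apply']
  exact prim_sub_prim hc (locInt_cut hI hd hc i) hx hz

theorem prim_iterate_cut_monotoneOn (hI : I.OrdConnected) {d : ℝ → ℝ} (hd : MonotoneOn d I) {c : ℝ}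
    (hc : c ∈ I) (i : ℕ) : MonotoneOn ((prim c)^[i] (cut d c)) I := by
  cases i with
  | zero => exact cut_monotoneOn hd c
  | succ i =>
    intro z hz x hx hzx
    rw [prim_iterate_succ_cut hI hd hc i hx hz]
    exact le_add_of_nonneg_right (intervalIntegral.integral_nonneg hzx fun u hu =>
      prim_iterate_cut_nonneg hI hd hc i (hI.out hz hx hu))

/-- Makes Taylor's formula at s available for the n-fold primitive from c, whose j-th derivative is
the (n - j)-fold one. -/
theorem isChain_cut (hI : I.OrdConnected) {d : ℝ → ℝ} (hd : MonotoneOn d I) {c : ℝ}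
    (hc : c ∈ I) (n : ℕ) : IsChain I (fun j => (prim c)^[n - j] (cut d c)) n := by
  intro j hj
  obtain ⟨i, rfl⟩ : ∃ i, n = j + 1 + i := ⟨n - (j + 1), by omega⟩
  have h1 : j + 1 + i - (j + 1) = i := by omega
  have h2 : j + 1 + i - j = i + 1 := by omega
  simp only [h1, h2]
  exact ⟨locInt_cut hI hd hc i, fun z hz x hx => prim_iterate_succ_cut hI hd hc i hx hz⟩

/-- In the extended sense, the iterated primitives of `cut d c` are those of a nondecreasing
function on the whole line. -/
theorem ofReal_prim_iterate_cut (hI : I.OrdConnected) (hlow : IsLowerSet I) {d : ℝ → ℝ}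
    (hd : MonotoneOn d I) {c : ℝ} (hc : c ∈ I) {g : ℝ → ℝ≥0∞}
    (hg : ∀ u ∈ I, g u = ENNReal.ofReal (cut d c u)) (i : ℕ) {x : ℝ} (hx : x ∈ I) :
    lprim^[i] g x = ENNReal.ofReal ((prim c)^[i] (cut d c) x) := by
  induction i generalizing x with
  | zero => exact hg x hx
  | succ i ih =>
    rw [Function.iterate_succ_apply', Function.iterate_succ_apply', lprim]
    have h0 : ∫⁻ u in Set.Iio x, lprim^[i] g u
        = ∫⁻ u in Set.Iio x, ENNReal.ofReal ((prim c)^[i] (cut d c) u) :=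
      setLIntegral_congr_fun measurableSet_Iio fun u hu => ih (hlow (le_of_lt hu) hx)
    rw [h0]
    rcases le_total c x with hcx | hxc
    · have h1 : ∫⁻ u in Set.Iio x, ENNReal.ofReal ((prim c)^[i] (cut d c) u)
          = ∫⁻ u in Set.Ioc c x, ENNReal.ofReal ((prim c)^[i] (cut d c) u) := by
        rw [← lintegral_indicator measurableSet_Iio, ← lintegral_indicator measurableSet_Ioc]
        refine lintegral_congr_ae ?_
        filter_upwards [Measure.ae_ne volume x] with u hux
        by_cases h1 : u < x
        · by_cases h2 : c < u
          · simp [Set.indicator, h1, h2, h1.le]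
          · simp [Set.indicator, h1, h2, prim_iterate_cut_eq_zero hI hd hc i
              (hlow h1.le hx) (not_lt.1 h2)]
        · have : ¬ u ≤ x := fun h => h1 (lt_of_le_of_ne h hux)
          simp [Set.indicator, h1, this]
      rw [h1, prim, intervalIntegral.integral_of_le hcx]
      refine (ofReal_integral_eq_lintegral_ofReal (locInt_cut hI hd hc i c hc x hx).1 ?_).symm
      exact (ae_restrict_mem measurableSet_Ioc).mono fun u hu =>
        prim_iterate_cut_nonneg hI hd hc i (hlow hu.2 hx)
    · have := prim_iterate_cut_eq_zero hI hd hc (i + 1) hx hxc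
      rw [Function.iterate_succ_apply'] at this
      rw [this, setLIntegral_congr_fun (g := fun _ => 0) measurableSet_Iio fun u hu => ?_]
      · simp
      · have hu' : u ≤ x := le_of_lt hu
        simp [prim_iterate_cut_eq_zero hI hd hc i (hlow hu' hx) (hu'.trans hxc)]

end

/-! ### Behaviour at `-∞` and approximation by truncations -/

section

open Filter Topology

variable {I : Set ℝ}

theorem exists_limit_atBot (hlow : IsLowerSet I) (hne : I.Nonempty) {d : ℝ → ℝ}
    (hd : MonotoneOn d I) (h0 : ∀ x ∈ I, 0 ≤ d x) :
    ∃ L, 0 ≤ L ∧ Tendsto d atBot (𝓝 L) ∧ ∀ x ∈ I, L ≤ d x := by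
  obtain ⟨s, hs⟩ := hne
  -- Freezing d at its value at s beyond s gives a monotone function on the whole line.
  have hmem : ∀ u, min u s ∈ I := fun u => hlow (min_le_right u s) hs
  have hmono : Monotone fun u => d (min u s) := fun u v huv =>
    hd (hmem u) (hmem v) (min_le_min_right s huv)
  have hb : BddBelow (Set.range fun u => d (min u s)) := by
    refine ⟨0, ?_⟩
    rintro _ ⟨u, rfl⟩
    exact h0 _ (hmem u)
  refine ⟨⨅ u, d (min u s), le_ciInf fun u => h0 _ (hmem u), ?_, fun x hx => ?_⟩
  · refine (tendsto_atBot_ciInf hmono hb).congr' ?_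
    filter_upwards [Iic_mem_atBot s] with u hu
    rw [min_eq_left hu]
  · exact (ciInf_le hb x).trans (hd (hmem x) hx (min_le_left x s))

theorem eq_zero_of_primitive_nonneg (hI : I.OrdConnected) (hlow : IsLowerSet I) (hne : I.Nonempty)
    {D d : ℝ → ℝ} (hd : LocInt I d) (hD : ∀ z ∈ I, ∀ x ∈ I, D x = D z + ∫ u in z..x, d u)
    (hD0 : ∀ x ∈ I, 0 ≤ D x) {L : ℝ} (hL : 0 ≤ L) (hLd : ∀ x ∈ I, L ≤ d x) : L = 0 := by
  obtain ⟨s, hs⟩ := hne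
  refine le_antisymm (not_lt.1 fun hpos => ?_) hL
  -- If L > 0, then D drops by at least D s + 1 over this distance to the left of s, hence becomes
  -- negative.
  have hr : 0 ≤ (D s + 1) / L := div_nonneg (by linarith [hD0 s hs]) hL
  set r := (D s + 1) / L with hrdef
  have hsr : s - r ∈ I := hlow (by linarith) hs
  have h1 : L * r ≤ ∫ u in (s - r)..s, d u := by
    have h2 : ∫ _ in (s - r)..s, L = L * r := by simp [mul_comm]
    rw [← h2]
    exact intervalIntegral.integral_mono_on (by linarith) (by simp) (hd _ hsr s hs)
      fun u hu => hLd u (hI.out hsr hs hu)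
  have h3 : L * r = D s + 1 := by rw [hrdef]; field_simp
  linarith [hD _ hsr s hs, hD0 _ hsr]

/-- The increment of D over [x - 1, x] is nonnegative, and it is at most d x because d is
nondecreasing. -/
theorem nonneg_of_primitive_monotoneOn (hI : I.OrdConnected) (hlow : IsLowerSet I)
    {D d : ℝ → ℝ} (hd : LocInt I d) (hD : ∀ z ∈ I, ∀ x ∈ I, D x = D z + ∫ u in z..x, d u)
    (hDm : MonotoneOn D I) (hdm : MonotoneOn d I) : ∀ x ∈ I, 0 ≤ d x := by
  intro x hx
  have hz : x - 1 ∈ I := hlow (by linarith) hx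
  have h1 : ∫ u in (x - 1)..x, d u ≤ d x := by
    have h2 : ∫ _ in (x - 1)..x, d x = d x := by simp
    conv_rhs => rw [← h2]
    exact intervalIntegral.integral_mono_on (by linarith) (hd _ hz x hx) (by simp)
      fun u hu => hdm (hI.out hz hx hu) hx hu.2
  linarith [hD _ hz x hx, hDm hz hx (by linarith)]

/-- Iterated primitives of truncations approximate functions vanishing at `-∞` together with
their derivatives. -/
theorem sub_prim_iterate_cut (hI : I.OrdConnected) (hlow : IsLowerSet I) (hne : I.Nonempty)
    {e : ℕ → ℝ → ℝ} {N : ℕ}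
    (hchain : ∀ i < N, ∀ z ∈ I, ∀ x ∈ I, e (i + 1) x = e (i + 1) z + ∫ u in z..x, e i u)
    (hmono : ∀ i ≤ N, MonotoneOn (e i) I) (hnn : ∀ i ≤ N, ∀ x ∈ I, 0 ≤ e i x)
    (hlim : ∀ i ≤ N, Tendsto (e i) atBot (𝓝 0)) {i : ℕ} (hi : i ≤ N) :
    (∀ c ∈ I, MonotoneOn (fun x => e i x - (prim c)^[i] (cut (e 0) c) x) I ∧
      ∀ x ∈ I, 0 ≤ e i x - (prim c)^[i] (cut (e 0) c) x) ∧
    ∀ x ∈ I, Tendsto (fun c => e i x - (prim c)^[i] (cut (e 0) c) x) atBot (𝓝 0) := by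
  have hd := hmono 0 N.zero_le
  have hmem : ∀ᶠ c in atBot, c ∈ I := by
    obtain ⟨s, hs⟩ := hne
    filter_upwards [Iic_mem_atBot s] with c hc using hlow hc hs
  induction i with
  | zero =>
    have key : ∀ c x, e 0 x - (prim c)^[0] (cut (e 0) c) x = min (e 0 x) (e 0 c) := by
      intro c x
      rw [Function.iterate_zero, id_eq, cut]
      rcases le_total (e 0 x) (e 0 c) with h | h
      · rw [max_eq_right (by linarith), min_eq_left h, sub_zero]
      · rw [max_eq_left (by linarith), min_eq_right h, sub_sub_cancel]
    simp only [key]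
    refine ⟨fun c hc => ⟨fun x hx y hy hxy => min_le_min_right _ (hd hx hy hxy), fun x hx =>
      le_min (hnn 0 N.zero_le x hx) (hnn 0 N.zero_le c hc)⟩, fun x hx => ?_⟩
    have := (tendsto_const_nhds (x := e 0 x)).min (hlim 0 N.zero_le)
    rwa [min_eq_right (hnn 0 N.zero_le x hx)] at this
  | succ i ih =>
    obtain ⟨ih1, ih2⟩ := ih (Nat.le_of_succ_le hi)
    have hinc : ∀ c ∈ I, ∀ z ∈ I, ∀ x ∈ I,
        e (i + 1) x - (prim c)^[i + 1] (cut (e 0) c) x =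
          (e (i + 1) z - (prim c)^[i + 1] (cut (e 0) c) z) +
          ∫ u in z..x, (e i u - (prim c)^[i] (cut (e 0) c) u) := by
      intro c hc z hz x hx
      rw [intervalIntegral.integral_sub
        (locInt_of_monotoneOn hI (hmono i (Nat.le_of_succ_le hi)) z hz x hx)
        (locInt_cut hI hd hc i z hz x hx), hchain i hi z hz x hx,
        prim_iterate_succ_cut hI hd hc i hx hz]
      ring
    have hm : ∀ c ∈ I, MonotoneOn (fun x => e (i + 1) x - (prim c)^[i + 1] (cut (e 0) c) x) I := by
      intro c hc z hz x hx hzx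
      simp only
      rw [hinc c hc z hz x hx]
      exact le_add_of_nonneg_right (intervalIntegral.integral_nonneg hzx fun u hu =>
        (ih1 c hc).2 u (hI.out hz hx hu))
    have hn : ∀ c ∈ I, ∀ x ∈ I, 0 ≤ e (i + 1) x - (prim c)^[i + 1] (cut (e 0) c) x := by
      intro c hc x hx
      -- At this point the truncated primitive vanishes, so the error there is e (i + 1) itself;
      -- monotonicity carries the sign to x.
      have hz : min x c ∈ I := hlow (min_le_left x c) hx
      refine le_trans ?_ (hm c hc hz hx (min_le_left x c))
      simp only
      rw [prim_iterate_cut_eq_zero hI hd hc (i + 1) hz (min_le_right x c), sub_zero]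
      exact hnn (i + 1) hi _ hz
    refine ⟨fun c hc => ⟨hm c hc, hn c hc⟩, fun x hx => ?_⟩
    rw [Metric.tendsto_nhds]
    intro δ hδ
    -- Fix z so far left that the error at z is below δ / 2 for all c; on [z, x] the error grows by
    -- at most (x - z) times the previous error at x, which tends to 0.
    have hz : ∀ᶠ z in atBot, z ≤ x ∧ e (i + 1) z < δ / 2 :=
      (eventually_le_atBot x).and ((hlim (i + 1) hi).eventually (gt_mem_nhds (half_pos hδ)))
    obtain ⟨z, hzx, hez⟩ := hz.exists
    have hzI : z ∈ I := hlow hzx hx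
    have h2 : Tendsto (fun c => (e i x - (prim c)^[i] (cut (e 0) c) x) * (x - z)) atBot (𝓝 0) := by
      simpa using (ih2 x hx).mul_const (x - z)
    filter_upwards [hmem, h2.eventually (gt_mem_nhds (half_pos hδ))] with c hc hc2
    rw [Real.dist_eq, sub_zero, abs_of_nonneg (hn c hc x hx), hinc c hc z hzI x hx]
    have h3 : ∫ u in z..x, (e i u - (prim c)^[i] (cut (e 0) c) u)
        ≤ (e i x - (prim c)^[i] (cut (e 0) c) x) * (x - z) := by
      have h4 : ∫ _ in z..x, (e i x - (prim c)^[i] (cut (e 0) c) x)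
          = (e i x - (prim c)^[i] (cut (e 0) c) x) * (x - z) := by
        rw [intervalIntegral.integral_const, smul_eq_mul, mul_comm]
      rw [← h4]
      exact intervalIntegral.integral_mono_on hzx
        (locInt_of_monotoneOn hI (ih1 c hc).1 z hzI x hx) (by simp)
        fun u hu => (ih1 c hc).1 (hI.out hzI hx hu) hx hu.2
    have h5 := prim_iterate_cut_nonneg hI hd hc (i + 1) hzI
    linarith

/-- L is the limit of D (m + 1) at -∞ when m < n. Monotonicity of both the truncation and the error,
normalized to vanish at s, is what later yields domination after m integrations from s. -/
theorem exists_truncation (hI : I.OrdConnected) (hlow : IsLowerSet I) {s : ℝ} (hs : s ∈ I)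
    {D : ℕ → ℝ → ℝ} {m n : ℕ} (hmn : m ≤ n) (hD : IsChain I D n)
    (hmono : ∀ j, m ≤ j → j ≤ n → MonotoneOn (D j) I) :
    ∃ L : ℝ, 0 ≤ L ∧ (m = n → L = 0) ∧
      MonotoneOn (fun x => D m x - D m s - L * (x - s)) I ∧
      (∀ c ∈ I, MonotoneOn (fun x => D m x - D m s - L * (x - s) -
        ((prim c)^[n - m] (cut (D n) c) x - (prim c)^[n - m] (cut (D n) c) s)) I) ∧
      ∀ x ∈ I, Tendsto (fun c => D m x - D m s - L * (x - s) -
        ((prim c)^[n - m] (cut (D n) c) x - (prim c)^[n - m] (cut (D n) c) s)) atBot (𝓝 0) := by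
  have hne : I.Nonempty := ⟨s, hs⟩
  have hmem : ∀ᶠ c in atBot, c ∈ I := by
    filter_upwards [Iic_mem_atBot s] with c hc using hlow hc hs
  rcases hmn.eq_or_lt with rfl | hlt
  · have hm := hmono m le_rfl le_rfl
    -- With m = n no slope is removed, and D m may be unbounded below; the error still vanishes once
    -- c ≤ s and c ≤ x.
    have key : ∀ c x, D m x - D m s - 0 * (x - s) -
        ((prim c)^[m - m] (cut (D m) c) x - (prim c)^[m - m] (cut (D m) c) s) =
        min (D m x) (D m c) - min (D m s) (D m c) := by
      have h1 : ∀ a b : ℝ, a - max (a - b) 0 = min a b := by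
        intro a b
        rcases le_total a b with h | h
        · rw [max_eq_right (by linarith), min_eq_left h, sub_zero]
        · rw [max_eq_left (by linarith), min_eq_right h, sub_sub_cancel]
      intro c x
      rw [Nat.sub_self, Function.iterate_zero, id_eq, cut, cut, ← h1, ← h1]
      ring
    refine ⟨0, le_rfl, fun _ => rfl, ?_, fun c hc => ?_, fun x hx => ?_⟩
    · intro x hx y hy hxy
      simpa using hm hx hy hxy
    · intro x hx y hy hxy
      simp only [key]
      exact sub_le_sub_right (min_le_min_right _ (hm hx hy hxy)) _
    · simp only [key]
      refine tendsto_const_nhds.congr' ?_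
      filter_upwards [Iic_mem_atBot s, Iic_mem_atBot x] with c hcs hcx
      have hc : c ∈ I := hlow hcs hs
      rw [min_eq_right (hm hc hx hcx), min_eq_right (hm hc hs hcs), sub_self]
  · obtain ⟨N, rfl⟩ : ∃ N, n = m + 1 + N := ⟨n - (m + 1), by omega⟩
    have hnn : ∀ j, m + 1 ≤ j → j ≤ m + 1 + N → ∀ x ∈ I, 0 ≤ D j x := by
      intro j hj1 hj2
      obtain ⟨j, rfl⟩ : ∃ j', j = j' + 1 := ⟨j - 1, by omega⟩
      obtain ⟨h1, h2⟩ := hD j (by omega)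
      exact nonneg_of_primitive_monotoneOn hI hlow h1 h2 (hmono j (by omega) (by omega))
        (hmono (j + 1) (by omega) hj2)
    -- A positive limit of D j would make D (j - 1) negative far to the left, but j - 1 ≥ m + 1
    -- still has D (j - 1) ≥ 0.
    have hzero : ∀ j, m + 1 < j → j ≤ m + 1 + N → Tendsto (D j) atBot (𝓝 0) := by
      intro j hj1 hj2
      obtain ⟨L, hL0, hL, hLd⟩ := exists_limit_atBot hlow hne (hmono j (by omega) hj2)
        (hnn j hj1.le hj2)
      obtain ⟨j, rfl⟩ : ∃ j', j = j' + 1 := ⟨j - 1, by omega⟩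
      obtain ⟨h1, h2⟩ := hD j (by omega)
      rwa [eq_zero_of_primitive_nonneg hI hlow hne h1 h2 (hnn j (by omega) (by omega)) hL0 hLd]
        at hL
    obtain ⟨L, hL0, hL, hLd⟩ := exists_limit_atBot hlow hne
      (hmono (m + 1) (by omega) (by omega)) (hnn (m + 1) le_rfl (by omega))
    obtain ⟨hloc, hint⟩ := hD m (by omega)
    -- The order is reversed, so that e (i + 1) is a primitive of e i; only the last function, D (m
    -- + 1), needs its limit subtracted.
    let e : ℕ → ℝ → ℝ := fun i x => D (m + 1 + (N - i)) x - if i = N then L else 0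
    have heN : ∀ x, e N x = D (m + 1) x - L := fun x => by simp [e]
    have he : ∀ i, i < N → e i = D (m + 1 + (N - i)) := fun i hi => by
      funext x; simp [e, hi.ne]
    have hcut : ∀ c, cut (D (m + 1 + N)) c = cut (e 0) c := by
      intro c; funext u; simp [cut, e]
    have hA := sub_prim_iterate_cut hI hlow hne (e := e) (N := N) ?_ ?_ ?_ ?_ le_rfl
    · obtain ⟨hA1, hA2⟩ := hA
      have hdm : MonotoneOn (e 0) I := fun x hx y hy hxy =>
        sub_le_sub_right (hmono (m + 1 + (N - 0)) (by omega) (by omega) hx hy hxy) _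
      have hnm : m + 1 + N - m = N + 1 := by omega
      have hinc0 : ∀ z ∈ I, ∀ x ∈ I, D m x - D m s - L * (x - s) =
          (D m z - D m s - L * (z - s)) + ∫ u in z..x, (D (m + 1) u - L) := by
        intro z hz x hx
        rw [intervalIntegral.integral_sub (hloc z hz x hx) (by simp), hint z hz x hx]
        simp only [intervalIntegral.integral_const, smul_eq_mul]
        ring
      have hinc : ∀ c ∈ I, ∀ z ∈ I, ∀ x ∈ I, D m x - D m s - L * (x - s) -
            ((prim c)^[N + 1] (cut (e 0) c) x - (prim c)^[N + 1] (cut (e 0) c) s) =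
          (D m z - D m s - L * (z - s) -
            ((prim c)^[N + 1] (cut (e 0) c) z - (prim c)^[N + 1] (cut (e 0) c) s)) +
            ∫ u in z..x, (e N u - (prim c)^[N] (cut (e 0) c) u) := by
        intro c hc z hz x hx
        simp_rw [heN]
        rw [intervalIntegral.integral_sub ((hloc z hz x hx).sub (by simp))
          (locInt_cut hI hdm hc N z hz x hx), hinc0 z hz x hx,
          prim_iterate_succ_cut hI hdm hc N hx hz]
        ring
      refine ⟨L, hL0, fun h => by omega, ?_, ?_, ?_⟩
      · intro z hz x hx hzx
        simp only
        rw [hinc0 z hz x hx]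
        exact le_add_of_nonneg_right (intervalIntegral.integral_nonneg hzx fun u hu =>
          sub_nonneg.2 (hLd u (hI.out hz hx hu)))
      · intro c hc z hz x hx hzx
        simp only [hnm, hcut]
        rw [hinc c hc z hz x hx]
        exact le_add_of_nonneg_right (intervalIntegral.integral_nonneg hzx fun u hu =>
          (hA1 c hc).2 u (hI.out hz hx hu))
      · intro x hx
        simp only [hnm, hcut]
        -- The integrand between s and x is nondecreasing, so its value at the larger endpoint
        -- bounds it.
        have hM : max s x ∈ I := by rcases max_choice s x with h | h <;> rw [h] <;> assumption
        refine squeeze_zero_norm' (a := fun c =>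
          (e N (max s x) - (prim c)^[N] (cut (e 0) c) (max s x)) * |x - s|) ?_ ?_
        · filter_upwards [hmem] with c hc
          rw [hinc c hc s hs x hx]
          simp only [sub_self, mul_zero, zero_add]
          refine intervalIntegral.norm_integral_le_of_norm_le_const fun u hu => ?_
          have hu' := Set.uIoc_subset_uIcc hu
          have huI := hI.uIcc_subset hs hx hu'
          rw [Real.norm_eq_abs, abs_of_nonneg ((hA1 c hc).2 u huI)]
          exact (hA1 c hc).1 huI hM hu'.2
        · simpa using (hA2 _ hM).mul_const |x - s|
    · intro i hi z hz x hx
      obtain ⟨j, rfl⟩ : ∃ j, N = i + 1 + j := ⟨N - (i + 1), by omega⟩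
      have h1 : i + 1 + j - i = j + 1 := by omega
      have h2 : i + 1 + j - (i + 1) = j := by omega
      have h3 := (hD (m + 1 + j) (by omega)).2 z hz x hx
      simp only [he i hi]
      simp only [e, h1, h2]
      rw [h3, add_assoc (m + 1) j 1]
      ring
    · intro i hi x hx y hy hxy
      exact sub_le_sub_right (hmono _ (by omega) (by omega) hx hy hxy) _
    · intro i hi x hx
      rcases hi.eq_or_lt with rfl | hi
      · rw [heN]
        exact sub_nonneg.2 (hLd x hx)
      · rw [he i hi]
        exact hnn _ (by omega) (by omega) x hx
    · intro i hi
      rcases hi.eq_or_lt with rfl | hi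
      · have : e i = fun x => D (m + 1) x - L := funext heN
        rw [this]
        simpa using hL.sub_const L
      · rw [he i hi]
        exact hzero _ (by omega) (by omega)

end

/-! ### Calculus of extended integrals -/

section

open Filter Topology

variable {α : Type*} [MeasurableSpace α] {ν : Measure α}

/-- A measurable function whose negative part has a finite integral. -/
def LowerIntegrable (ν : Measure α) (f : α → ℝ) : Prop :=
  Measurable f ∧ (∫⁻ x, ENNReal.ofReal (-f x) ∂ν) < ∞

theorem LowerIntegrable.measurable_neg {f : α → ℝ} (hf : LowerIntegrable ν f) :
    Measurable fun x => ENNReal.ofReal (-f x) := hf.1.neg.ennreal_ofReal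

theorem LowerIntegrable.integralExists {f : α → ℝ} (hf : LowerIntegrable ν f) :
    IntegralExists ν f := Or.inr hf.2

theorem lowerIntegrable_of_bot_lt {f : α → ℝ} (hm : Measurable f)
    (h : ⊥ < extIntegral ν f) : LowerIntegrable ν f := by
  refine ⟨hm, lt_top_iff_ne_top.2 fun htop => ?_⟩
  rw [extIntegral, htop] at h
  simp at h

theorem integrable_iff_lintegral_ofReal {f : α → ℝ} (hm : Measurable f) :
    Integrable f ν ↔ (∫⁻ x, ENNReal.ofReal (f x) ∂ν) < ∞ ∧
      (∫⁻ x, ENNReal.ofReal (-f x) ∂ν) < ∞ := by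
  have h : ∫⁻ x, ‖f x‖ₑ ∂ν
      = (∫⁻ x, ENNReal.ofReal (f x) ∂ν) + ∫⁻ x, ENNReal.ofReal (-f x) ∂ν := by
    rw [← lintegral_add_left hm.ennreal_ofReal]
    refine lintegral_congr fun x => ?_
    rw [Real.enorm_eq_ofReal_abs]
    rcases le_total 0 (f x) with h | h
    · rw [abs_of_nonneg h, ENNReal.ofReal_of_nonpos (by linarith : -f x ≤ 0), add_zero]
    · rw [abs_of_nonpos h, ENNReal.ofReal_of_nonpos h, zero_add]
  rw [← ENNReal.add_lt_top, ← h]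
  exact ⟨fun hf => hf.2, fun hf => ⟨hm.aestronglyMeasurable, hf⟩⟩

theorem _root_.MeasureTheory.Integrable.lowerIntegrable {f : α → ℝ} (hm : Measurable f)
    (hf : Integrable f ν) : LowerIntegrable ν f :=
  ⟨hm, ((integrable_iff_lintegral_ofReal hm).1 hf).2⟩

theorem extIntegral_eq_integral {f : α → ℝ} (hm : Measurable f) (hf : Integrable f ν) :
    extIntegral ν f = ((∫ x, f x ∂ν : ℝ) : EReal) := by
  obtain ⟨h1, h2⟩ := (integrable_iff_lintegral_ofReal hm).1 hf
  rw [integral_eq_lintegral_pos_part_sub_lintegral_neg_part hf, extIntegral]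
  lift ∫⁻ x, ENNReal.ofReal (f x) ∂ν to NNReal using h1.ne with a
  lift ∫⁻ x, ENNReal.ofReal (-f x) ∂ν to NNReal using h2.ne with b
  rfl

theorem integrable_of_extIntegral_eq {f : α → ℝ} (hm : Measurable f) {m : ℝ}
    (h : extIntegral ν f = (m : EReal)) : Integrable f ν ∧ ∫ x, f x ∂ν = m := by
  have hl : LowerIntegrable ν f := lowerIntegrable_of_bot_lt hm (h ▸ EReal.bot_lt_coe m)
  have hi : Integrable f ν := by
    refine (integrable_iff_lintegral_ofReal hm).2 ⟨lt_top_iff_ne_top.2 fun htop => ?_, hl.2⟩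
    rw [extIntegral, htop] at h
    have h2 := hl.2.ne
    lift ∫⁻ x, ENNReal.ofReal (-f x) ∂ν to NNReal using h2 with b
    exact (EReal.coe_ne_top m) (h.symm.trans (EReal.top_sub_coe b))
  refine ⟨hi, ?_⟩
  rw [extIntegral_eq_integral hm hi] at h
  exact_mod_cast h

theorem extIntegral_of_nonneg {f : α → ℝ} (h0 : ∀ x, 0 ≤ f x) :
    extIntegral ν f = ((∫⁻ x, ENNReal.ofReal (f x) ∂ν : ℝ≥0∞) : EReal) := by
  have : ∫⁻ x, ENNReal.ofReal (-f x) ∂ν = 0 := by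
    simp [ENNReal.ofReal_of_nonpos, h0]
  simp [extIntegral, this]

theorem LowerIntegrable.of_nonneg {f : α → ℝ} (hm : Measurable f) (h0 : ∀ x, 0 ≤ f x) :
    LowerIntegrable ν f := by
  refine ⟨hm, ?_⟩
  simp [ENNReal.ofReal_of_nonpos, h0]

theorem LowerIntegrable.add {f g : α → ℝ} (hf : LowerIntegrable ν f) (hg : LowerIntegrable ν g) :
    LowerIntegrable ν (fun x => f x + g x) := by
  refine ⟨hf.1.add hg.1, lt_of_le_of_lt ?_ (ENNReal.add_lt_top.2 ⟨hf.2, hg.2⟩)⟩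
  rw [← lintegral_add_left hf.measurable_neg]
  refine lintegral_mono fun x => ?_
  rw [neg_add]
  exact ENNReal.ofReal_add_le

theorem LowerIntegrable.const_mul {f : α → ℝ} (hf : LowerIntegrable ν f) {a : ℝ} (ha : 0 ≤ a) :
    LowerIntegrable ν (fun x => a * f x) := by
  refine ⟨hf.1.const_mul a, ?_⟩
  simp_rw [← mul_neg, ENNReal.ofReal_mul ha]
  rw [lintegral_const_mul _ hf.measurable_neg]
  exact ENNReal.mul_lt_top ENNReal.ofReal_lt_top hf.2

theorem extIntegral_add {f g : α → ℝ} (hf : LowerIntegrable ν f) (hg : LowerIntegrable ν g) :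
    extIntegral ν (fun x => f x + g x) = extIntegral ν f + extIntegral ν g := by
  have hfg := hf.add hg
  -- The identity (f+g)₊ + f₋ + g₋ = (f+g)₋ + f₊ + g₊ avoids subtraction in `ℝ≥0∞`.
  have key : (∫⁻ x, ENNReal.ofReal (f x + g x) ∂ν) +
      ((∫⁻ x, ENNReal.ofReal (-f x) ∂ν) + ∫⁻ x, ENNReal.ofReal (-g x) ∂ν) =
      (∫⁻ x, ENNReal.ofReal (-(f x + g x)) ∂ν) +
      ((∫⁻ x, ENNReal.ofReal (f x) ∂ν) + ∫⁻ x, ENNReal.ofReal (g x) ∂ν) := by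
    rw [← lintegral_add_left hf.measurable_neg, ← lintegral_add_left hf.1.ennreal_ofReal,
      ← lintegral_add_left hfg.1.ennreal_ofReal, ← lintegral_add_left hfg.measurable_neg]
    refine lintegral_congr fun x => ?_
    have hpm : ∀ r : ℝ, max r 0 - max (-r) 0 = r := fun r => by
      rcases le_total 0 r with h | h <;> simp [h]
    have h1 := hpm (f x)
    have h2 := hpm (g x)
    have h3 := hpm (f x + g x)
    rw [← ENNReal.toReal_eq_toReal_iff' (by finiteness) (by finiteness),
      ENNReal.toReal_add (by finiteness) (by finiteness),
      ENNReal.toReal_add (by finiteness) (by finiteness),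
      ENNReal.toReal_add (by finiteness) (by finiteness),
      ENNReal.toReal_add (by finiteness) (by finiteness)]
    simp only [ENNReal.toReal_ofReal']
    linarith
  unfold extIntegral
  have h1 := hf.2.ne
  have h2 := hg.2.ne
  have h3 := hfg.2.ne
  lift ∫⁻ x, ENNReal.ofReal (-f x) ∂ν to NNReal using h1 with b
  lift ∫⁻ x, ENNReal.ofReal (-g x) ∂ν to NNReal using h2 with b'
  lift ∫⁻ x, ENNReal.ofReal (-(f x + g x)) ∂ν to NNReal using h3 with b''
  generalize ∫⁻ x, ENNReal.ofReal (f x) ∂ν = a at *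
  generalize ∫⁻ x, ENNReal.ofReal (g x) ∂ν = a' at *
  generalize ∫⁻ x, ENNReal.ofReal (f x + g x) ∂ν = a'' at *
  induction a with
  | top =>
    have : a'' = ⊤ := by simpa using key
    subst this
    have h : ⊥ < ((a' : ℝ≥0∞) : EReal) - ((b' : ℝ≥0∞) : EReal) := by
      induction a' with
      | top => exact bot_lt_top
      | coe a' => exact EReal.bot_lt_coe ((a' : ℝ) - (b' : ℝ))
    exact (EReal.top_add_of_ne_bot h.ne').symm
  | coe a =>
    induction a' with
    | top =>
      have : a'' = ⊤ := by simpa using key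
      subst this
      exact (EReal.add_top_of_ne_bot (EReal.coe_ne_bot ((a : ℝ) - (b : ℝ)))).symm
    | coe a' =>
      induction a'' with
      | top => exact absurd ((top_add _).symm.trans key).symm (by finiteness)
      | coe a'' =>
        have h : (a'' : ℝ) + (b + b') = b'' + (a + a') := by exact_mod_cast key
        change (((a'' : ℝ) - b'' : ℝ) : EReal) = ((((a : ℝ) - b) + ((a' : ℝ) - b') : ℝ) : EReal)
        congr 1
        linarith

theorem extIntegral_const_mul {f : α → ℝ} (hf : LowerIntegrable ν f) {a : ℝ} (ha : 0 ≤ a) :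
    extIntegral ν (fun x => a * f x) = (a : EReal) * extIntegral ν f := by
  have h2 := hf.2.ne
  have h3 : ∫⁻ x, ENNReal.ofReal (a * f x) ∂ν
      = ENNReal.ofReal a * ∫⁻ x, ENNReal.ofReal (f x) ∂ν := by
    simp_rw [ENNReal.ofReal_mul ha]
    exact lintegral_const_mul _ hf.1.ennreal_ofReal
  have h4 : ∫⁻ x, ENNReal.ofReal (-(a * f x)) ∂ν
      = ENNReal.ofReal a * ∫⁻ x, ENNReal.ofReal (-f x) ∂ν := by
    simp_rw [← mul_neg, ENNReal.ofReal_mul ha]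
    exact lintegral_const_mul _ hf.measurable_neg
  unfold extIntegral
  rw [h3, h4]
  lift ∫⁻ x, ENNReal.ofReal (-f x) ∂ν to NNReal using h2 with b
  generalize ∫⁻ x, ENNReal.ofReal (f x) ∂ν = A
  lift a to NNReal using ha
  rw [ENNReal.ofReal_coe_nnreal]
  induction A with
  | top =>
    rcases eq_or_ne a 0 with rfl | h
    · simp
    · have hpos : (0 : ℝ) < a := by positivity
      rw [ENNReal.mul_top (by simpa using h), ← ENNReal.coe_mul]
      change (⊤ : EReal) - (((a * b : NNReal) : ℝ) : EReal)
        = ((a : ℝ) : EReal) * ((⊤ : EReal) - ((b : ℝ) : EReal))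
      rw [EReal.top_sub_coe, EReal.top_sub_coe, EReal.coe_mul_top_of_pos hpos]
  | coe A =>
    rw [← ENNReal.coe_mul, ← ENNReal.coe_mul]
    change ((((a * A : NNReal) : ℝ) - ((a * b : NNReal) : ℝ) : ℝ) : EReal)
      = (((a : ℝ) * ((A : ℝ) - b) : ℝ) : EReal)
    congr 1
    push_cast
    ring

/-- Fatou gives the lower bound and the pointwise bound by the limit gives the upper one, so the
limit may have infinite integral. -/
theorem tendsto_lintegral_of_le_limit {F : ℕ → α → ℝ≥0∞} {f : α → ℝ≥0∞}
    (hF : ∀ i, Measurable (F i)) (hle : ∀ i x, F i x ≤ f x)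
    (hlim : ∀ x, Tendsto (fun i => F i x) atTop (𝓝 (f x))) :
    Tendsto (fun i => ∫⁻ x, F i x ∂ν) atTop (𝓝 (∫⁻ x, f x ∂ν)) := by
  refine tendsto_of_le_liminf_of_limsup_le ?_ ?_
  · calc ∫⁻ x, f x ∂ν = ∫⁻ x, liminf (fun i => F i x) atTop ∂ν :=
          lintegral_congr fun x => (hlim x).liminf_eq.symm
      _ ≤ _ := lintegral_liminf_le hF
  · refine limsup_le_of_le (h := Eventually.of_forall fun i => lintegral_mono (hle i))

theorem tendsto_extIntegral {F : ℕ → α → ℝ} {f : α → ℝ} (hF : ∀ i, Measurable (F i))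
    (hf : LowerIntegrable ν f) (hpos : ∀ i x, ENNReal.ofReal (F i x) ≤ ENNReal.ofReal (f x))
    (hneg : ∀ i x, ENNReal.ofReal (-F i x) ≤ ENNReal.ofReal (-f x))
    (hlim : ∀ x, Tendsto (fun i => F i x) atTop (𝓝 (f x))) :
    Tendsto (fun i => extIntegral ν (F i)) atTop (𝓝 (extIntegral ν f)) := by
  have h1 : Tendsto (fun i => ∫⁻ x, ENNReal.ofReal (F i x) ∂ν) atTop
      (𝓝 (∫⁻ x, ENNReal.ofReal (f x) ∂ν)) :=
    tendsto_lintegral_of_le_limit (fun i => (hF i).ennreal_ofReal) hpos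
      fun x => (ENNReal.continuous_ofReal.tendsto _).comp (hlim x)
  have h2 : Tendsto (fun i => ∫⁻ x, ENNReal.ofReal (-F i x) ∂ν) atTop
      (𝓝 (∫⁻ x, ENNReal.ofReal (-f x) ∂ν)) :=
    tendsto_lintegral_of_le_limit (fun i => (hF i).neg.ennreal_ofReal) hneg
      fun x => (ENNReal.continuous_ofReal.tendsto _).comp (hlim x).neg
  have h1' := (continuous_coe_ennreal_ereal.tendsto _).comp h1
  have h2' := ((continuous_coe_ennreal_ereal.tendsto _).comp h2).neg
  refine (EReal.continuousAt_add (p := (_, _)) (Or.inr ?_) (Or.inl ?_)).tendsto.comp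
    (h1'.prodMk_nhds h2')
  · simpa using hf.2.ne
  · simp

end

/-! ### Generalized derivatives and polynomials in the cone -/

section

open Filter Topology

variable {I : Set ℝ}

theorem extendZero_coe (g : I → ℝ) (x : I) : extendZero I g x = g x :=
  Subtype.val_injective.extend_apply g 0 x

theorem continuousWithinAt_extendZero {g : I → ℝ} {S : Set I} {x : I}
    (h : ContinuousWithinAt g S x) :
    ContinuousWithinAt (extendZero I g) (Subtype.val '' S) (x : ℝ) := by
  rw [ContinuousWithinAt, ← Topology.IsEmbedding.subtypeVal.map_nhdsWithin_eq S x,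
    tendsto_map'_iff, extendZero_coe]
  exact Tendsto.congr (fun y => (extendZero_coe g y).symm) h

/-- One-sided fundamental theorem of calculus: right continuity of g at x suffices. -/
theorem IsGenDeriv.hasDerivWithinAt_right (hI : I.OrdConnected) {f g : I → ℝ}
    (h : IsGenDeriv I f g) {x y : I} (hxy : x < y) :
    HasDerivWithinAt (extendZero I f) (g x) (Set.Icc (x : ℝ) y) x := by
  have hxy' : (x : ℝ) < y := hxy
  have hint := h.intervalIntegrable x y
  have hc : ContinuousWithinAt (extendZero I g) (Set.Ioi (x : ℝ)) x := by
    have h1 := continuousWithinAt_extendZero ((h.isLD x).1 ⟨y, hxy⟩)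
    refine h1.mono_of_mem_nhdsWithin ?_
    filter_upwards [Ioc_mem_nhdsGT hxy'] with u hu
    exact ⟨⟨u, hI.out x.2 y.2 ⟨hu.1.le, hu.2⟩⟩, hu.1.le, rfl⟩
  have hm : StronglyMeasurableAtFilter (extendZero I g) (𝓝[>] (x : ℝ)) :=
    ⟨Set.Ioc x y, Ioc_mem_nhdsGT hxy', hint.1.aestronglyMeasurable⟩
  have hd := (intervalIntegral.integral_hasDerivWithinAt_right (a := (x : ℝ)) (b := (x : ℝ))
    (s := Set.Ici (x : ℝ)) (t := Set.Ioi (x : ℝ)) (by simp) hm hc).mono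
      (Set.Icc_subset_Ici_self : Set.Icc (x : ℝ) y ⊆ _)
  rw [extendZero_coe] at hd
  refine (hd.const_add (f x)).congr_of_mem (fun u hu => ?_) (Set.left_mem_Icc.2 hxy'.le)
  have hu' : u ∈ I := hI.out x.2 y.2 hu
  exact (extendZero_coe f ⟨u, hu'⟩).trans (h.eq_add_integral x ⟨u, hu'⟩)

theorem IsGenDeriv.hasDerivWithinAt_left (hI : I.OrdConnected) {f g : I → ℝ}
    (h : IsGenDeriv I f g) {x y : I} (hyx : y < x) (hmax : ∀ u : I, u ≤ x) :
    HasDerivWithinAt (extendZero I f) (g x) (Set.Icc (y : ℝ) x) x := by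
  have hyx' : (y : ℝ) < x := hyx
  have hint := h.intervalIntegrable y x
  have hc : ContinuousWithinAt (extendZero I g) (Set.Iic (x : ℝ)) x := by
    have h1 := continuousWithinAt_extendZero ((h.isLD x).2 hmax)
    refine h1.mono_of_mem_nhdsWithin ?_
    filter_upwards [Ioc_mem_nhdsLE hyx'] with u hu
    exact ⟨⟨u, hI.out y.2 x.2 ⟨hu.1.le, hu.2⟩⟩, hu.2, rfl⟩
  have hm : StronglyMeasurableAtFilter (extendZero I g) (𝓝[≤] (x : ℝ)) :=
    ⟨Set.Ioc y x, Ioc_mem_nhdsLE hyx', hint.1.aestronglyMeasurable⟩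
  have hd := (intervalIntegral.integral_hasDerivWithinAt_right (a := (x : ℝ)) (b := (x : ℝ))
    (s := Set.Iic (x : ℝ)) (t := Set.Iic (x : ℝ)) (by simp) hm hc).mono
      (Set.Icc_subset_Iic_self : Set.Icc (y : ℝ) x ⊆ _)
  rw [extendZero_coe] at hd
  refine (hd.const_add (f x)).congr_of_mem (fun u hu => ?_) (Set.right_mem_Icc.2 hyx'.le)
  have hu' : u ∈ I := hI.out y.2 x.2 hu
  exact (extendZero_coe f ⟨u, hu'⟩).trans (h.eq_add_integral x ⟨u, hu'⟩)

theorem IsGenDeriv.unique (hI : I.OrdConnected) (ha : ¬ BddBelow I) {f g g' : I → ℝ}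
    (h : IsGenDeriv I f g) (h' : IsGenDeriv I f g') : g = g' := by
  funext x
  by_cases hx : ∃ y : I, x < y
  · obtain ⟨y, hxy⟩ := hx
    exact (uniqueDiffOn_Icc (show (x : ℝ) < y from hxy) x (Set.left_mem_Icc.2 hxy.le)).eq_deriv _
      (h.hasDerivWithinAt_right hI hxy) (h'.hasDerivWithinAt_right hI hxy)
  · push Not at hx
    obtain ⟨y, hy, hyx⟩ := not_bddBelow_iff.1 ha x
    exact (uniqueDiffOn_Icc hyx x (Set.right_mem_Icc.2 hyx.le)).eq_deriv _
      (h.hasDerivWithinAt_left hI (y := ⟨y, hy⟩) hyx hx)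
      (h'.hasDerivWithinAt_left hI (y := ⟨y, hy⟩) hyx hx)

theorem IsIterGenDeriv.unique (hI : I.OrdConnected) (ha : ¬ BddBelow I) {j : ℕ} {f g g' : I → ℝ}
    (h : IsIterGenDeriv I j f g) (h' : IsIterGenDeriv I j f g') : g = g' := by
  induction j generalizing g g' with
  | zero => exact h.2.trans h'.2.symm
  | succ j ih =>
    obtain ⟨q, hq, hqg⟩ := h
    obtain ⟨q', hq', hqg'⟩ := h'
    obtain rfl := ih hq hq'
    exact hqg.unique hI ha hqg'

theorem IsIterGenDeriv.measurable {j : ℕ} {f g : I → ℝ} (h : IsIterGenDeriv I j f g) :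
    Measurable f := by
  induction j generalizing g with
  | zero => exact h.1
  | succ j ih =>
    obtain ⟨q, hq, -⟩ := h
    exact ih hq

theorem IsIterGenDeriv.exists_of_le {n : ℕ} {f g : I → ℝ} (h : IsIterGenDeriv I n f g) {j : ℕ}
    (hj : j ≤ n) : ∃ q, IsIterGenDeriv I j f q := by
  induction n generalizing g with
  | zero => exact ⟨g, by rwa [Nat.le_zero.1 hj]⟩
  | succ n ih =>
    rcases hj.eq_or_lt with rfl | hlt
    · exact ⟨g, h⟩
    · obtain ⟨q, hq, -⟩ := h
      exact ih hq (Nat.lt_succ_iff.1 hlt)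

theorem measurable_of_mem_monoCone {k n : ℕ} {f : I → ℝ} (hf : f ∈ monoCone I k n) :
    Measurable f := by
  obtain ⟨⟨g, hg⟩, -⟩ := hf
  exact hg.measurable

/-- The cone provides a monotone derivative separately for each order; uniqueness glues them into
one chain. -/
theorem exists_chain_of_mem_monoCone (hI : I.OrdConnected) (ha : ¬ BddBelow I) {k n : ℕ}
    {f : I → ℝ} (hf : f ∈ monoCone I k n) :
    ∃ D : ℕ → ℝ → ℝ, (∀ x : I, D 0 x = f x) ∧ IsChain I D n ∧
      ∀ j, k ≤ j + 1 → j ≤ n → MonotoneOn (D j) I := by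
  obtain ⟨⟨g, hg⟩, hmono⟩ := hf
  have hex : ∀ j, ∃ q : I → ℝ, j ≤ n → IsIterGenDeriv I j f q := by
    intro j
    by_cases hj : j ≤ n
    · obtain ⟨q, hq⟩ := hg.exists_of_le hj
      exact ⟨q, fun _ => hq⟩
    · exact ⟨0, fun h => absurd h hj⟩
  choose D hD using hex
  refine ⟨fun j => extendZero I (D j), fun x => ?_, fun j hj => ?_, fun j hkj hj => ?_⟩
  · exact (extendZero_coe (D 0) x).trans (by rw [(hD 0 n.zero_le).2])
  · obtain ⟨q, hq, hqg⟩ := hD (j + 1) hj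
    obtain rfl := hq.unique hI ha (hD j hj.le)
    refine ⟨fun a ha b hb => hqg.intervalIntegrable ⟨a, ha⟩ ⟨b, hb⟩, fun z hz x hx => ?_⟩
    exact (extendZero_coe (D j) ⟨x, hx⟩).trans ((hqg.eq_add_integral ⟨z, hz⟩ ⟨x, hx⟩).trans
      (by rw [← extendZero_coe (D j) ⟨z, hz⟩]))
  · obtain ⟨q, hq, hqm⟩ := hmono j hkj hj
    obtain rfl := hq.unique hI ha (hD j hj)
    intro x hx y hy hxy
    have := hqm (show (⟨x, hx⟩ : I) ≤ ⟨y, hy⟩ from hxy)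
    rwa [← extendZero_coe (D j) ⟨x, hx⟩, ← extendZero_coe (D j) ⟨y, hy⟩] at this

theorem isGenDeriv_polynomial (hI : I.OrdConnected) (p : Polynomial ℝ) :
    IsGenDeriv I (fun x => p.eval (x : ℝ)) (fun x => p.derivative.eval (x : ℝ)) := by
  have hext : ∀ z x : I, Set.EqOn (fun u => p.derivative.eval u)
      (extendZero I fun x => p.derivative.eval (x : ℝ)) (Set.uIcc (z : ℝ) x) := fun z x u hu =>
    (extendZero_coe (fun x : I => p.derivative.eval (x : ℝ))
      ⟨u, hI.uIcc_subset z.2 x.2 hu⟩).symm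
  have hcont : Continuous fun x : I => p.derivative.eval (x : ℝ) :=
    p.derivative.continuous.comp continuous_subtype_val
  refine ⟨fun x => ⟨fun _ => hcont.continuousWithinAt, fun _ => hcont.continuousWithinAt⟩,
    fun z x => ?_, fun z x => ?_⟩
  · exact (p.derivative.continuous.intervalIntegrable z x).congr
      ((hext z x).mono Set.uIoc_subset_uIcc)
  · rw [← intervalIntegral.integral_congr (hext z x),
      intervalIntegral.integral_eq_sub_of_hasDerivAt (fun u _ => p.hasDerivAt u)
        (p.derivative.continuous.intervalIntegrable z x)]
    ring

theorem isIterGenDeriv_polynomial (hI : I.OrdConnected) (p : Polynomial ℝ) (j : ℕ) :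
    IsIterGenDeriv I j (fun x => p.eval (x : ℝ))
      (fun x => (Polynomial.derivative^[j] p).eval (x : ℝ)) := by
  induction j with
  | zero => exact ⟨p.continuous.measurable.comp measurable_subtype_coe, rfl⟩
  | succ j ih =>
    refine ⟨_, ih, ?_⟩
    rw [Function.iterate_succ_apply']
    exact isGenDeriv_polynomial hI _

theorem polynomial_mem_monoCone (hI : I.OrdConnected) {k n : ℕ} {p : Polynomial ℝ}
    (hp : ∀ j, k ≤ j + 1 → Monotone fun x : ℝ => (Polynomial.derivative^[j] p).eval x) :
    (fun x : I => p.eval (x : ℝ)) ∈ monoCone I k n :=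
  ⟨⟨_, isIterGenDeriv_polynomial hI p n⟩, fun j hkj _ =>
    ⟨_, isIterGenDeriv_polynomial hI p j, fun _ _ hxy => hp j hkj hxy⟩⟩

/-- All derivatives of order at least k - 1 are constant. The condition is invariant under negation,
which is how equalities arise in (i). -/
theorem polynomial_mem_monoCone_of_natDegree_lt (hI : I.OrdConnected) {k n : ℕ} {p : Polynomial ℝ}
    (hp : p.natDegree < k) : (fun x : I => p.eval (x : ℝ)) ∈ monoCone I k n := by
  refine polynomial_mem_monoCone hI fun j hj => ?_
  have h0 : (Polynomial.derivative^[j] p).natDegree = 0 := by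
    have := Polynomial.natDegree_iterate_derivative p j
    omega
  rw [Polynomial.eq_C_of_natDegree_eq_zero h0]
  simpa using monotone_const

theorem pow_mem_monoCone (hI : I.OrdConnected) {k : ℕ} (n : ℕ) (z : ℝ) :
    (fun x : I => ((Polynomial.X - Polynomial.C z) ^ k).eval (x : ℝ)) ∈ monoCone I k n := by
  refine polynomial_mem_monoCone hI fun j hj => ?_
  rw [Polynomial.iterate_derivative_X_sub_pow]
  simp only [Polynomial.eval_smul, Polynomial.eval_pow, Polynomial.eval_sub, Polynomial.eval_X,
    Polynomial.eval_C]
  have h1 : k - j ≤ 1 := by omega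
  intro x y hxy
  simp only
  refine nsmul_le_nsmul_right ?_ _
  interval_cases k - j
  · simp
  · simpa using hxy

end

/-! ### Comparison of expectations over the cone -/

section

open Filter Topology

variable {I : Set ℝ} {Ω Ω' : Type*} [MeasurableSpace Ω] [MeasurableSpace Ω']
  {P : Measure Ω} {P' : Measure Ω'} {X : Ω → I} {Y : Ω' → I}

theorem isLowerSet_of_not_bddBelow (hI : I.OrdConnected) (ha : ¬ BddBelow I) : IsLowerSet I := by
  intro x y hyx hx
  obtain ⟨z, hz, hzy⟩ := not_bddBelow_iff.1 ha y
  exact hI.out hz hx ⟨hzy.le, hyx⟩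

theorem lowerIntegrable_of_admissible {G : Set (I → ℝ)} (hX : Measurable X)
    (hadm : P.map X ∈ admissible I G) {f : I → ℝ} (hf : f ∈ G) (hm : Measurable f) :
    LowerIntegrable P (fun ω => f (X ω)) := by
  refine lowerIntegrable_of_bot_lt (hm.comp hX) ?_
  have h := (hadm f hf).2
  have hn : Measurable fun x => ENNReal.ofReal (-f x) := hm.neg.ennreal_ofReal
  rwa [extIntegral, lintegral_map hm.ennreal_ofReal hX, lintegral_map hn hX] at h

theorem LowerIntegrable.integralGE_iff {α β : Type*} [MeasurableSpace α] [MeasurableSpace β]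
    {μ : Measure α} {ν : Measure β} {f : α → ℝ} {g : β → ℝ} (hf : LowerIntegrable μ f)
    (hg : LowerIntegrable ν g) : IntegralGE μ f ν g ↔ extIntegral ν g ≤ extIntegral μ f :=
  ⟨fun h => h.2.2, fun h => ⟨hf.integralExists, hg.integralExists, h⟩⟩

/-- I is a lower set, so its complement lies above it and the value ∞ there keeps monotonicity on
the whole line. -/
theorem ofReal_cut_extension_monotone (hlow : IsLowerSet I) {d : ℝ → ℝ} (hd : MonotoneOn d I)
    (c : ℝ) [DecidablePred (· ∈ I)] :
    Monotone fun u => if u ∈ I then ENNReal.ofReal (cut d c u) else ⊤ := by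
  intro u v huv
  by_cases hv : v ∈ I
  · have hu : u ∈ I := hlow huv hv
    simp only [hu, hv, if_true]
    exact ENNReal.ofReal_le_ofReal (cut_monotoneOn hd c hu hv huv)
  · simp [hv]

theorem lintegral_prim_iterate_cut_le [SFinite P] [SFinite P'] (hI : I.OrdConnected)
    (hlow : IsLowerSet I) (hX : Measurable X) (hY : Measurable Y) {n : ℕ}
    (h : ∀ t : I, ∫⁻ ω, ENNReal.ofReal (posPow ((Y ω : ℝ) - t) n) ∂P' ≤
      ∫⁻ ω, ENNReal.ofReal (posPow ((X ω : ℝ) - t) n) ∂P)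
    {d : ℝ → ℝ} (hd : MonotoneOn d I) {c : ℝ} (hc : c ∈ I) :
    ∫⁻ ω, ENNReal.ofReal ((prim c)^[n] (cut d c) (Y ω)) ∂P' ≤
      ∫⁻ ω, ENNReal.ofReal ((prim c)^[n] (cut d c) (X ω)) ∂P := by
  classical
  have hX' : Measurable fun ω => (X ω : ℝ) := measurable_subtype_coe.comp hX
  have hY' : Measurable fun ω => (Y ω : ℝ) := measurable_subtype_coe.comp hY
  have hg := ofReal_cut_extension_monotone hlow hd c
  set g : ℝ → ℝ≥0∞ := fun u => if u ∈ I then ENNReal.ofReal (cut d c u) else ⊤ with hgdef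
  have hgI : ∀ u ∈ I, g u = ENNReal.ofReal (cut d c u) := fun u hu => by simp [hgdef, hu]
  have hgc : g c = 0 := by simp [hgI c hc, cut]
  have hgm := (lprim_iterate_mono hg n).measurable
  have key := lintegral_lprim_iterate_le n (μ := P.map fun ω => (X ω : ℝ))
    (ν := P'.map fun ω => (Y ω : ℝ)) (fun t => ?_) hg hgc
  · rw [lintegral_map hgm hX', lintegral_map hgm hY'] at key
    simpa only [ofReal_prim_iterate_cut hI hlow hd hc hgI n (Subtype.coe_prop _)] using key
  · have hp : Measurable fun x : ℝ => ENNReal.ofReal (posPow (x - t) n / n.factorial) :=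
      ((measurable_posPow n t).div_const _).ennreal_ofReal
    rw [lintegral_map hp hX', lintegral_map hp hY']
    have hfac : (0 : ℝ) < n.factorial := by positivity
    simp_rw [ENNReal.ofReal_div_of_pos hfac, div_eq_mul_inv]
    have hpX : Measurable fun ω => ENNReal.ofReal (posPow ((X ω : ℝ) - t) n) :=
      ((measurable_posPow n t).comp hX').ennreal_ofReal
    have hpY : Measurable fun ω => ENNReal.ofReal (posPow ((Y ω : ℝ) - t) n) :=
      ((measurable_posPow n t).comp hY').ennreal_ofReal
    rw [lintegral_mul_const _ hpX, lintegral_mul_const _ hpY]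
    gcongr ?_ * _
    by_cases ht : t ∈ I
    · exact h ⟨t, ht⟩
    -- A knot outside I lies above all values of Y.
    · have h0 : ∀ ω, posPow ((Y ω : ℝ) - t) n = 0 := fun ω =>
        if_neg fun hle => ht (hlow (sub_nonneg.1 hle) (Y ω).2)
      simp [h0]

theorem measurable_comp_of_monotoneOn (hlow : IsLowerSet I) (hX : Measurable X) {h : ℝ → ℝ}
    (hh : MonotoneOn h I) : Measurable fun ω => h (X ω) := by
  have : Monotone fun x : I => h x := fun x y hxy => hh x.2 y.2 hxy
  have hI := hlow.ordConnected
  exact this.measurable.comp hX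

theorem measurable_polynomial_comp (hX : Measurable X) (q : Polynomial ℝ) :
    Measurable fun ω => q.eval (X ω : ℝ) :=
  q.continuous.measurable.comp (measurable_subtype_coe.comp hX)

/-- Decomposition of the integral of `f = p + a (· - s)^(m + 1) + R`, with `R` of the same sign as
the power. -/
theorem extIntegral_eq_of_decomposition (hX : Measurable X) {f : I → ℝ} {R : ℝ → ℝ} {a s : ℝ}
    {m : ℕ} {p : Polynomial ℝ} (ha : 0 ≤ a)
    (hdec : ∀ x : I, f x = p.eval (x : ℝ) + a * ((x : ℝ) - s) ^ (m + 1) + R x)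
    (hle : ∀ x : I, ENNReal.ofReal (-R x) ≤
      ENNReal.ofReal (-(a * ((x : ℝ) - s) ^ (m + 1) + R x)))
    (hp : Integrable (fun ω => p.eval (X ω : ℝ)) P)
    (hpow : a ≠ 0 → LowerIntegrable P (fun ω => ((X ω : ℝ) - s) ^ (m + 1)))
    (hf : LowerIntegrable P (fun ω => f (X ω))) :
    LowerIntegrable P (fun ω => R (X ω)) ∧
      extIntegral P (fun ω => f (X ω)) = extIntegral P (fun ω => p.eval (X ω : ℝ)) +
        a * extIntegral P (fun ω => ((X ω : ℝ) - s) ^ (m + 1)) +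
        extIntegral P (fun ω => R (X ω)) := by
  have hpm : Measurable fun ω => p.eval (X ω : ℝ) := measurable_polynomial_comp hX p
  have hpl := hp.lowerIntegrable hpm
  have hnl : LowerIntegrable P (fun ω => -p.eval (X ω : ℝ)) := hp.neg.lowerIntegrable hpm.neg
  have hfp := hf.add hnl
  have hQ : LowerIntegrable P (fun ω => a * ((X ω : ℝ) - s) ^ (m + 1)) ∧
      extIntegral P (fun ω => a * ((X ω : ℝ) - s) ^ (m + 1)) =
        a * extIntegral P (fun ω => ((X ω : ℝ) - s) ^ (m + 1)) := by
    -- For a = 0 nothing is known about the power, but 0 times any extended integral is 0.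
    rcases eq_or_ne a 0 with rfl | h0
    · exact ⟨by simp [LowerIntegrable], by simp [extIntegral]⟩
    · exact ⟨(hpow h0).const_mul ha, extIntegral_const_mul (hpow h0) ha⟩
  have hR : LowerIntegrable P (fun ω => R (X ω)) := by
    refine ⟨?_, lt_of_le_of_lt (lintegral_mono fun ω => (hle (X ω)).trans (le_of_eq ?_)) hfp.2⟩
    · have : (fun ω => R (X ω)) =
          fun ω => f (X ω) - p.eval (X ω : ℝ) - a * ((X ω : ℝ) - s) ^ (m + 1) := by
        funext ω; rw [hdec]; ring
      rw [this]
      exact (hf.1.sub hpm).sub hQ.1.1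
    · simp only [hdec]
      congr 2
      ring
  refine ⟨hR, ?_⟩
  rw [← hQ.2, ← extIntegral_add hpl hQ.1, ← extIntegral_add (hpl.add hQ.1) hR]
  simp_rw [hdec]

theorem extIntegral_le_of_mem_monoCone [SFinite P] [SFinite P']
    (hI : I.OrdConnected) (ha : ¬ BddBelow I) {m n : ℕ} (hmn : m ≤ n)
    (hX : Measurable X) (hY : Measurable Y)
    (hpoly : ∀ p : Polynomial ℝ, p.natDegree ≤ m →
      Integrable (fun ω => p.eval (X ω : ℝ)) P ∧ Integrable (fun ω => p.eval (Y ω : ℝ)) P' ∧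
        ∫ ω, p.eval (Y ω : ℝ) ∂P' = ∫ ω, p.eval (X ω : ℝ) ∂P)
    (hpow : m < n → ∀ s : ℝ, LowerIntegrable P (fun ω => ((X ω : ℝ) - s) ^ (m + 1)) ∧
      LowerIntegrable P' (fun ω => ((Y ω : ℝ) - s) ^ (m + 1)) ∧
      extIntegral P' (fun ω => ((Y ω : ℝ) - s) ^ (m + 1)) ≤
        extIntegral P (fun ω => ((X ω : ℝ) - s) ^ (m + 1)))
    (htrunc : ∀ t : I, ∫⁻ ω, ENNReal.ofReal (posPow ((Y ω : ℝ) - t) n) ∂P' ≤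
      ∫⁻ ω, ENNReal.ofReal (posPow ((X ω : ℝ) - t) n) ∂P)
    {f : I → ℝ} (hf : f ∈ monoCone I (m + 1) n) (hfX : LowerIntegrable P (fun ω => f (X ω)))
    (hfY : LowerIntegrable P' (fun ω => f (Y ω))) :
    extIntegral P' (fun ω => f (Y ω)) ≤ extIntegral P (fun ω => f (X ω)) := by
  have hlow := isLowerSet_of_not_bddBelow hI ha
  obtain ⟨s, hs, -⟩ := not_bddBelow_iff.1 ha 0
  obtain ⟨D, hD0, hD, hmono⟩ := exists_chain_of_mem_monoCone hI ha hf
  obtain ⟨L, hL0, hL, he, hed, helim⟩ := exists_truncation hI hlow hs hmn hD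
    fun j hj hjn => hmono j (by omega) hjn
  obtain ⟨p, hp, hpD⟩ := (hD.of_le hmn).exists_taylor hI hs
  have hDn : MonotoneOn (D n) I := hmono n (by omega) le_rfl
  set e : ℝ → ℝ := fun x => D m x - D m s - L * (x - s) with hedef
  let c : ℕ → ℝ := fun i => s - i
  have hc : ∀ i, c i ∈ I := fun i => hlow (sub_le_self s (Nat.cast_nonneg i)) hs
  let e' : ℕ → ℝ → ℝ := fun i x =>
    (prim (c i))^[n - m] (cut (D n) (c i)) x - (prim (c i))^[n - m] (cut (D n) (c i)) s
  have he' : ∀ i, MonotoneOn (e' i) I := fun i x hx y hy hxy =>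
    sub_le_sub_right (prim_iterate_cut_monotoneOn hI hDn (hc i) _ hx hy hxy) _
  have hed' : ∀ i, MonotoneOn (fun x => e x - e' i x) I := fun i => hed (c i) (hc i)
  have hes : e s = 0 := by simp [hedef]
  have hes' : ∀ i, e' i s = 0 := fun i => sub_self _
  have hctop : Tendsto c atTop atBot := by
    have := tendsto_neg_atTop_atBot.comp (tendsto_natCast_atTop_atTop (R := ℝ))
    simpa [c, sub_eq_add_neg] using tendsto_atBot_add_const_left _ s this
  have helim' : ∀ x ∈ I, Tendsto (fun i => e x - e' i x) atTop (𝓝 0) := fun x hx =>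
    (helim x hx).comp hctop
  let R : ℝ → ℝ := (prim s)^[m] e
  let R' : ℕ → ℝ → ℝ := fun i => (prim s)^[m] (e' i)
  let Q : ℝ → ℝ := fun x => L * (x - s) ^ (m + 1) / (m + 1).factorial
  have hfR : ∀ x : I, f x = (p.eval (x : ℝ) + Q x) + R x := by
    intro x
    rw [← hD0 x, hpD x x.2]
    have h1 : (fun u => D m u - D m s) = fun u => L * (u - s) + e u := by
      funext u; simp only [hedef]; ring
    rw [h1, prim_iterate_add hI hs ((by fun_prop : Continuous fun u => L * (u - s)).locInt)
      (locInt_of_monotoneOn hI he) m x.2, prim_iterate_linear]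
    simp only [Q, R]
    ring
  have hRR' : ∀ i, ∀ x ∈ I, R x - R' i x = (prim s)^[m] (fun u => e u - e' i u) x := by
    intro i x hx
    have h1 : e = fun u => e' i u + (e u - e' i u) := by funext u; ring
    have h2 : R x = R' i x + (prim s)^[m] (fun u => e u - e' i u) x := by
      simp only [R]
      conv_lhs => rw [h1]
      exact prim_iterate_add hI hs (locInt_of_monotoneOn hI (he' i))
        (locInt_of_monotoneOn hI (hed' i)) m hx
    rw [h2]; ring
  -- Taylor's formula at s for the n-fold primitive from c i, solved for its remainder, which is R'
  -- i.
  have hcut : ∀ i, ∃ q : Polynomial ℝ, q.natDegree ≤ m ∧ ∀ x ∈ I,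
      R' i x = (prim (c i))^[n] (cut (D n) (c i)) x + q.eval x := by
    intro i
    obtain ⟨q, hq, hqx⟩ := ((isChain_cut hI hDn (hc i) n).of_le hmn).exists_taylor hI hs
    refine ⟨-q, by rwa [Polynomial.natDegree_neg], fun x hx => ?_⟩
    have := hqx x hx
    simp only [Nat.sub_zero] at this
    rw [this, Polynomial.eval_neg]
    simp only [R', e']
    ring
  -- A single sign at x serves R, Q, R' i and R - R' i at once.
  have hsign : ∀ x ∈ I, ∃ ε : ℝ, (ε = 1 ∨ ε = -1) ∧ 0 ≤ ε * R x ∧ 0 ≤ ε * Q x ∧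
      ∀ i, 0 ≤ ε * R' i x ∧ 0 ≤ ε * (R x - R' i x) := by
    intro x hx
    obtain ⟨ε, hε, h⟩ := exists_sign_prim_iterate hI hs m hx
    refine ⟨ε, hε, h e he hes, ?_, fun i => ⟨h _ (he' i) (hes' i), ?_⟩⟩
    · have := h (fun u => L * (u - s))
        (fun u _ v _ huv => mul_le_mul_of_nonneg_left (sub_le_sub_right huv s) hL0) (by simp)
      rwa [prim_iterate_linear] at this
    · rw [hRR' i x hx]
      exact h _ (hed' i) (by simp [hes, hes'])
  have hRpos : ∀ i, ∀ x ∈ I, ENNReal.ofReal (R' i x) ≤ ENNReal.ofReal (R x) := by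
    intro i x hx
    obtain ⟨ε, rfl | rfl, h1, -, h3⟩ := hsign x hx
    · exact ENNReal.ofReal_le_ofReal (by linarith [(h3 i).2])
    · rw [ENNReal.ofReal_of_nonpos (by linarith [(h3 i).1])]; exact zero_le
  have hRneg : ∀ i, ∀ x ∈ I, ENNReal.ofReal (-R' i x) ≤ ENNReal.ofReal (-R x) := by
    intro i x hx
    obtain ⟨ε, rfl | rfl, h1, -, h3⟩ := hsign x hx
    · rw [ENNReal.ofReal_of_nonpos (by linarith [(h3 i).1])]; exact zero_le
    · exact ENNReal.ofReal_le_ofReal (by linarith [(h3 i).2])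
  have hRlim : ∀ x ∈ I, Tendsto (fun i => R' i x) atTop (𝓝 (R x)) := by
    intro x hx
    have h1 : Tendsto (fun i => R x - R' i x) atTop (𝓝 0) := by
      -- The error e - e' i is monotone and vanishes at s, so between s and x it is largest in
      -- absolute value at x.
      refine squeeze_zero_norm (a := fun i => |e x - e' i x| * |x - s| ^ m) (fun i => ?_) ?_
      · rw [hRR' i x hx, Real.norm_eq_abs]
        refine abs_prim_iterate_le (fun u hu => ?_) m Set.right_mem_uIcc
        have huI := hI.uIcc_subset hs hx hu
        have h0 : e s - e' i s = 0 := by rw [hes, hes' i, sub_zero]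
        rcases le_total s x with hsx | hxs
        · rw [Set.uIcc_of_le hsx] at hu
          have h2 := hed' i hs huI hu.1
          have h3 := hed' i huI hx hu.2
          simp only [h0] at h2 h3
          rw [abs_of_nonneg h2, abs_of_nonneg (h2.trans h3)]
          exact h3
        · rw [Set.uIcc_of_ge hxs] at hu
          have h2 := hed' i huI hs hu.2
          have h3 := hed' i hx huI hu.1
          simp only [h0] at h2 h3
          rw [abs_of_nonpos h2, abs_of_nonpos (h3.trans h2)]
          exact neg_le_neg h3
      · simpa using (helim' x hx).abs.mul_const (|x - s| ^ m)
    simpa using h1.const_sub (R x)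
  have ha0 : 0 ≤ L / (m + 1).factorial := by positivity
  have hdec : ∀ x : I, f x = p.eval (x : ℝ) +
      L / (m + 1).factorial * ((x : ℝ) - s) ^ (m + 1) + R x := by
    intro x
    rw [hfR x]
    simp only [Q]
    ring
  have hle : ∀ x : I, ENNReal.ofReal (-R x) ≤
      ENNReal.ofReal (-(L / (m + 1).factorial * ((x : ℝ) - s) ^ (m + 1) + R x)) := by
    intro x
    have hQx : L / (m + 1).factorial * ((x : ℝ) - s) ^ (m + 1) = Q x := by simp only [Q]; ring
    rw [hQx]
    obtain ⟨ε, rfl | rfl, h1, h2, -⟩ := hsign x x.2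
    · rw [ENNReal.ofReal_of_nonpos (by linarith)]; exact zero_le
    · exact ENNReal.ofReal_le_ofReal (by linarith)
  -- For m = n the slope L is 0, so the power enters only when k ≤ n.
  have hlt : L / (m + 1).factorial ≠ 0 → m < n := fun h =>
    lt_of_le_of_ne hmn fun hmn' => h (by rw [hL hmn', zero_div])
  obtain ⟨hpX, hpY, hpXY⟩ := hpoly p hp
  obtain ⟨hRX, hX_eq⟩ := extIntegral_eq_of_decomposition hX ha0 hdec hle hpX
    (fun h => (hpow (hlt h) s).1) hfX
  obtain ⟨hRY, hY_eq⟩ := extIntegral_eq_of_decomposition hY ha0 hdec hle hpY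
    (fun h => (hpow (hlt h) s).2.1) hfY
  have hpoly_eq : ∀ q : Polynomial ℝ, q.natDegree ≤ m →
      extIntegral P' (fun ω => q.eval (Y ω : ℝ)) = extIntegral P (fun ω => q.eval (X ω : ℝ)) := by
    intro q hq
    obtain ⟨h1, h2, h3⟩ := hpoly q hq
    rw [extIntegral_eq_integral (measurable_polynomial_comp hX q) h1,
      extIntegral_eq_integral (measurable_polynomial_comp hY q) h2, h3]
  have hR'_dec : ∀ i, Measurable (fun ω => R' i (X ω)) ∧ Measurable (fun ω => R' i (Y ω)) ∧
      extIntegral P' (fun ω => R' i (Y ω)) ≤ extIntegral P (fun ω => R' i (X ω)) := by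
    intro i
    obtain ⟨q, hq, hqR⟩ := hcut i
    obtain ⟨h1, h2, -⟩ := hpoly q hq
    have hFm := prim_iterate_cut_monotoneOn hI hDn (hc i) n
    have hF0 : ∀ x : I, 0 ≤ (prim (c i))^[n] (cut (D n) (c i)) x := fun x =>
      prim_iterate_cut_nonneg hI hDn (hc i) n x.2
    have hFX : LowerIntegrable P (fun ω => (prim (c i))^[n] (cut (D n) (c i)) (X ω)) :=
      LowerIntegrable.of_nonneg (measurable_comp_of_monotoneOn hlow hX hFm) fun ω => hF0 _
    have hFY : LowerIntegrable P' (fun ω => (prim (c i))^[n] (cut (D n) (c i)) (Y ω)) :=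
      LowerIntegrable.of_nonneg (measurable_comp_of_monotoneOn hlow hY hFm) fun ω => hF0 _
    have hqX := h1.lowerIntegrable (measurable_polynomial_comp hX q)
    have hqY := h2.lowerIntegrable (measurable_polynomial_comp hY q)
    have hX1 : (fun ω => R' i (X ω)) =
        fun ω => (prim (c i))^[n] (cut (D n) (c i)) (X ω) + q.eval (X ω : ℝ) :=
      funext fun ω => hqR _ (X ω).2
    have hY1 : (fun ω => R' i (Y ω)) =
        fun ω => (prim (c i))^[n] (cut (D n) (c i)) (Y ω) + q.eval (Y ω : ℝ) :=
      funext fun ω => hqR _ (Y ω).2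
    rw [hX1, hY1]
    refine ⟨(hFX.add hqX).1, (hFY.add hqY).1, ?_⟩
    rw [extIntegral_add hFX hqX, extIntegral_add hFY hqY, hpoly_eq q hq,
      extIntegral_of_nonneg fun ω => hF0 _, extIntegral_of_nonneg fun ω => hF0 _]
    exact add_le_add (EReal.coe_ennreal_le_coe_ennreal_iff.2
      (lintegral_prim_iterate_cut_le hI hlow hX hY htrunc hDn (hc i))) le_rfl
  have hR_le : extIntegral P' (fun ω => R (Y ω)) ≤ extIntegral P (fun ω => R (X ω)) :=
    le_of_tendsto_of_tendsto'
      (tendsto_extIntegral (fun i => (hR'_dec i).2.1) hRY (fun i ω => hRpos i _ (Y ω).2)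
        (fun i ω => hRneg i _ (Y ω).2) fun ω => hRlim _ (Y ω).2)
      (tendsto_extIntegral (fun i => (hR'_dec i).1) hRX (fun i ω => hRpos i _ (X ω).2)
        (fun i ω => hRneg i _ (X ω).2) fun ω => hRlim _ (X ω).2)
      fun i => (hR'_dec i).2.2
  rw [hX_eq, hY_eq, hpoly_eq p hp]
  refine add_le_add (add_le_add le_rfl ?_) hR_le
  rcases eq_or_ne (L / (m + 1).factorial) 0 with h0 | h0
  · simp [h0]
  · exact mul_le_mul_of_nonneg_left (hpow (hlt h0) s).2.2 (EReal.coe_nonneg.2 ha0)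

/-- Two monic polynomials of equal degree: the leading terms cancel. This frees (ii) from its centre
z. -/
theorem pow_eq_add_eval (s z : ℝ) (m : ℕ) : ∃ q : Polynomial ℝ, q.natDegree ≤ m ∧
    ∀ x : ℝ, (x - s) ^ (m + 1) = (x - z) ^ (m + 1) + q.eval x := by
  refine ⟨(Polynomial.X - Polynomial.C s) ^ (m + 1) - (Polynomial.X - Polynomial.C z) ^ (m + 1),
    ?_, fun x => by simp⟩
  have hmonic : ∀ r : ℝ, ((Polynomial.X - Polynomial.C r) ^ (m + 1)).Monic := fun r =>
    (Polynomial.monic_X_sub_C r).pow _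
  have hdeg : ∀ r : ℝ,
      ((Polynomial.X - Polynomial.C r) ^ (m + 1)).degree = ((m + 1 : ℕ) : WithBot ℕ) :=
    fun r => by rw [Polynomial.degree_pow, Polynomial.degree_X_sub_C]; simp
  have hlt := Polynomial.degree_sub_lt_left ((hdeg s).trans (hdeg z).symm) (hmonic s).ne_zero
    ((hmonic s).leadingCoeff.trans (hmonic z).leadingCoeff.symm)
  rw [hdeg s] at hlt
  exact Polynomial.natDegree_le_of_degree_le (Order.le_of_lt_succ (by exact_mod_cast hlt))

theorem eval_eq_sum_taylor (p : Polynomial ℝ) {m : ℕ} (hp : p.natDegree ≤ m) (s x : ℝ) :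
    p.eval x = ∑ i ∈ Finset.range (m + 1), (Polynomial.taylor s p).coeff i * (x - s) ^ i := by
  rw [← Polynomial.eval_eq_sum_range' (by rw [Polynomial.natDegree_taylor]; omega),
    Polynomial.taylor_eval, sub_add_cancel]

end

/-! ### Moments and membership of the test functions -/

section

variable {I : Set ℝ} {Ω Ω' : Type*} [MeasurableSpace Ω] [MeasurableSpace Ω']
  {P : Measure Ω} {P' : Measure Ω'} {X : Ω → I} {Y : Ω' → I}

theorem IntegralEqReal.integrable {α β : Type*} [MeasurableSpace α] [MeasurableSpace β]
    {μ : Measure α} {ν : Measure β} {f : α → ℝ} {g : β → ℝ} (hf : Measurable f)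
    (hg : Measurable g) (h : IntegralEqReal μ f ν g) :
    Integrable f μ ∧ Integrable g ν ∧ ∫ x, g x ∂ν = ∫ x, f x ∂μ := by
  obtain ⟨-, -, r, h1, h2⟩ := h
  obtain ⟨hf1, hf2⟩ := integrable_of_extIntegral_eq hf h1
  obtain ⟨hg1, hg2⟩ := integrable_of_extIntegral_eq hg h2
  exact ⟨hf1, hg1, hg2.trans hf2.symm⟩

theorem polynomial_moments_eq [IsProbabilityMeasure P] [IsProbabilityMeasure P']
    (hX : Measurable X) (hY : Measurable Y) {m : ℕ} {s : ℝ}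
    (h : ∀ i : ℕ, 1 ≤ i → i + 1 ≤ m + 1 → IntegralEqReal P (fun ω => ((X ω : ℝ) - s) ^ i)
      P' (fun ω => ((Y ω : ℝ) - s) ^ i)) (p : Polynomial ℝ) (hp : p.natDegree ≤ m) :
    Integrable (fun ω => p.eval (X ω : ℝ)) P ∧ Integrable (fun ω => p.eval (Y ω : ℝ)) P' ∧
      ∫ ω, p.eval (Y ω : ℝ) ∂P' = ∫ ω, p.eval (X ω : ℝ) ∂P := by
  have hX' : Measurable fun ω => (X ω : ℝ) := measurable_subtype_coe.comp hX
  have hY' : Measurable fun ω => (Y ω : ℝ) := measurable_subtype_coe.comp hY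
  have hmom : ∀ i ∈ Finset.range (m + 1), Integrable (fun ω => ((X ω : ℝ) - s) ^ i) P ∧
      Integrable (fun ω => ((Y ω : ℝ) - s) ^ i) P' ∧
      ∫ ω, ((Y ω : ℝ) - s) ^ i ∂P' = ∫ ω, ((X ω : ℝ) - s) ^ i ∂P := by
    intro i hi
    rcases Nat.eq_zero_or_pos i with rfl | hpos
    · simp
    · exact (h i hpos (by have := Finset.mem_range.1 hi; omega)).integrable
        ((hX'.sub_const s).pow_const i) ((hY'.sub_const s).pow_const i)
  have h1 : ∀ i ∈ Finset.range (m + 1),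
      Integrable (fun ω => (Polynomial.taylor s p).coeff i * ((X ω : ℝ) - s) ^ i) P :=
    fun i hi => (hmom i hi).1.const_mul _
  have h2 : ∀ i ∈ Finset.range (m + 1),
      Integrable (fun ω => (Polynomial.taylor s p).coeff i * ((Y ω : ℝ) - s) ^ i) P' :=
    fun i hi => (hmom i hi).2.1.const_mul _
  simp_rw [eval_eq_sum_taylor p hp s]
  refine ⟨integrable_finsetSum _ h1, integrable_finsetSum _ h2, ?_⟩
  rw [integral_finsetSum _ h1, integral_finsetSum _ h2]
  refine Finset.sum_congr rfl fun i hi => ?_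
  rw [integral_const_mul, integral_const_mul, (hmom i hi).2.2]

theorem lowerIntegrable_posPow (hX : Measurable X) (t : ℝ) (n : ℕ) :
    LowerIntegrable P (fun ω => posPow ((X ω : ℝ) - t) n) :=
  LowerIntegrable.of_nonneg ((measurable_posPow n t).comp (measurable_subtype_coe.comp hX))
    fun _ => posPow_nonneg _ _

theorem polynomial_mem_of_natDegree_lt (hI : I.OrdConnected) {k n : ℕ} (hkn : k ≤ n + 1)
    {G : Set (I → ℝ)} (hG : (polyClass I n ∩ monoCone I k n) ∪ truncPowers I n ⊆ G)
    {p : Polynomial ℝ} (hp : p.natDegree < k) : (fun x : I => p.eval (x : ℝ)) ∈ G :=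
  hG (Or.inl ⟨⟨p, by omega, fun _ => rfl⟩, polynomial_mem_monoCone_of_natDegree_lt hI hp⟩)

theorem pow_mem (hI : I.OrdConnected) {k n : ℕ} (hkn : k ≤ n)
    {G : Set (I → ℝ)} (hG : (polyClass I n ∩ monoCone I k n) ∪ truncPowers I n ⊆ G) (z : ℝ) :
    (fun x : I => ((x : ℝ) - z) ^ k) ∈ G := by
  have h : (fun x : I => ((x : ℝ) - z) ^ k)
      = fun x : I => ((Polynomial.X - Polynomial.C z) ^ k).eval (x : ℝ) := by funext x; simp
  rw [h]
  refine hG (Or.inl ⟨⟨_, ?_, fun _ => rfl⟩, pow_mem_monoCone hI n z⟩)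
  rwa [Polynomial.natDegree_pow, Polynomial.natDegree_X_sub_C, mul_one]

end

end MultMono

/-! ### The characterization -/

theorem mainTheorem6
    (I : Set ℝ) (hI : I.OrdConnected) (ha : ¬ BddBelow I)
    (k n : ℕ) (hk : 1 ≤ k) (hkn : k ≤ n + 1)
    (G : Set (I → ℝ))
    (hG_lower : (MultMono.polyClass I n ∩ MultMono.monoCone I k n) ∪ MultMono.truncPowers I n ⊆ G)
    (hG_upper : G ⊆ MultMono.monoCone I k n)
    {Ω Ω' : Type*} [MeasurableSpace Ω] [MeasurableSpace Ω']
    (P : MeasureTheory.Measure Ω) [MeasureTheory.IsProbabilityMeasure P]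
    (P' : MeasureTheory.Measure Ω') [MeasureTheory.IsProbabilityMeasure P']
    (X : Ω → I) (hX : Measurable X) (Y : Ω' → I) (hY : Measurable Y)
    (hX_adm : P.map X ∈ MultMono.admissible I G)
    (hY_adm : P'.map Y ∈ MultMono.admissible I G)
    (s z : ℝ) :
    (∀ f ∈ G, MultMono.IntegralGE P (fun ω => f (X ω)) P' (fun ω => f (Y ω))) ↔
      ((∀ i : ℕ, 1 ≤ i → i + 1 ≤ k →
          MultMono.IntegralEqReal P (fun ω => ((X ω : ℝ) - s) ^ i)
            P' (fun ω => ((Y ω : ℝ) - s) ^ i)) ∧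
        (k ≤ n →
          MultMono.IntegralGE P (fun ω => ((X ω : ℝ) - z) ^ k)
            P' (fun ω => ((Y ω : ℝ) - z) ^ k)) ∧
        (∀ t : I,
          MultMono.IntegralGE P (fun ω => MultMono.posPow ((X ω : ℝ) - t) n)
            P' (fun ω => MultMono.posPow ((Y ω : ℝ) - t) n))) := by
  obtain ⟨m, rfl⟩ : ∃ m, k = m + 1 := ⟨k - 1, by omega⟩
  have hmeas : ∀ f ∈ G, Measurable f := fun f hf =>
    MultMono.measurable_of_mem_monoCone (hG_upper hf)
  have hlX : ∀ f ∈ G, MultMono.LowerIntegrable P (fun ω => f (X ω)) := fun f hf =>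
    MultMono.lowerIntegrable_of_admissible hX hX_adm hf (hmeas f hf)
  have hlY : ∀ f ∈ G, MultMono.LowerIntegrable P' (fun ω => f (Y ω)) := fun f hf =>
    MultMono.lowerIntegrable_of_admissible hY hY_adm hf (hmeas f hf)
  constructor
  · intro h
    refine ⟨fun i _ hi => ?_, fun hmn => h _ (MultMono.pow_mem hI hmn hG_lower z), fun t => ?_⟩
    · let p : Polynomial ℝ := (Polynomial.X - Polynomial.C s) ^ i
      have hpd : p.natDegree < m + 1 := by
        simp only [p, Polynomial.natDegree_pow, Polynomial.natDegree_X_sub_C]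
        omega
      have hpG := MultMono.polynomial_mem_of_natDegree_lt hI hkn hG_lower hpd
      -- Admissibility applied to both p and -p makes p integrable, and the two inequalities then
      -- give equality.
      have hnG := MultMono.polynomial_mem_of_natDegree_lt hI hkn hG_lower
        ((Polynomial.natDegree_neg p).trans_lt hpd)
      have hev : ∀ x : ℝ, (x - s) ^ i = p.eval x := fun x => by simp [p]
      have hpX := MultMono.measurable_polynomial_comp hX p
      have hpY := MultMono.measurable_polynomial_comp hY p
      have hnX := MultMono.measurable_polynomial_comp hX (-p)
      have hnY := MultMono.measurable_polynomial_comp hY (-p)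
      have hnlX := hlX _ hnG
      have hnlY := hlY _ hnG
      have hle := (h _ hpG).2.2
      have hge := (h _ hnG).2.2
      simp only [Polynomial.eval_neg] at hnX hnY hnlX hnlY hge
      have hiX := (MultMono.integrable_iff_lintegral_ofReal hpX).2
        ⟨by simpa using hnlX.2, (hlX _ hpG).2⟩
      have hiY := (MultMono.integrable_iff_lintegral_ofReal hpY).2
        ⟨by simpa using hnlY.2, (hlY _ hpG).2⟩
      rw [MultMono.extIntegral_eq_integral hpX hiX, MultMono.extIntegral_eq_integral hpY hiY] at hle
      rw [MultMono.extIntegral_eq_integral hnX hiX.neg,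
        MultMono.extIntegral_eq_integral hnY hiY.neg,
        MeasureTheory.integral_neg, MeasureTheory.integral_neg] at hge
      have hle' := EReal.coe_le_coe_iff.1 hle
      have hge' := EReal.coe_le_coe_iff.1 hge
      have heq : ∫ ω, p.eval (Y ω : ℝ) ∂P' = ∫ ω, p.eval (X ω : ℝ) ∂P := by linarith
      simp_rw [hev]
      exact ⟨(hlX _ hpG).integralExists, (hlY _ hpG).integralExists, _,
        MultMono.extIntegral_eq_integral hpX hiX,
        heq ▸ MultMono.extIntegral_eq_integral hpY hiY⟩
    · have hmem : (fun x : I => MultMono.posPow ((x : ℝ) - t) n / (n.factorial : ℝ)) ∈ G :=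
        hG_lower (Or.inr ⟨t, fun _ => rfl⟩)
      have hfac : (0 : ℝ) ≤ n.factorial := Nat.cast_nonneg _
      have hcancel : ∀ u : ℝ, MultMono.posPow u n =
          n.factorial * (MultMono.posPow u n / n.factorial) := fun u => by
        rw [mul_div_cancel₀ _ (by positivity)]
      refine ((MultMono.lowerIntegrable_posPow hX t n).integralGE_iff
        (MultMono.lowerIntegrable_posPow hY t n)).2 ?_
      rw [funext fun ω => hcancel ((X ω : ℝ) - t), funext fun ω => hcancel ((Y ω : ℝ) - t),
        MultMono.extIntegral_const_mul (hlX _ hmem) hfac,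
        MultMono.extIntegral_const_mul (hlY _ hmem) hfac]
      exact mul_le_mul_of_nonneg_left (h _ hmem).2.2 (EReal.coe_nonneg.2 hfac)
  · rintro ⟨h1, h2, h3⟩ f hf
    have hpoly := MultMono.polynomial_moments_eq hX hY h1
    refine ((hlX f hf).integralGE_iff (hlY f hf)).2 ?_
    refine MultMono.extIntegral_le_of_mem_monoCone hI ha (Nat.le_of_succ_le_succ hkn) hX hY hpoly
      (fun hmn r => ?_) (fun t => ?_) (hG_upper hf) (hlX f hf) (hlY f hf)
    -- The Taylor centre r is a point of I chosen from f's expansion, whereas (ii) is stated at z;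
    -- the two powers differ by a polynomial whose expectations agree by (i).
    · have hz := MultMono.pow_mem hI hmn hG_lower z
      obtain ⟨q, hq, hqr⟩ := MultMono.pow_eq_add_eval r z m
      obtain ⟨hqX, hqY, hqXY⟩ := hpoly q hq
      have hmX := MultMono.measurable_polynomial_comp hX q
      have hmY := MultMono.measurable_polynomial_comp hY q
      have hr := MultMono.pow_mem hI hmn hG_lower r
      refine ⟨hlX _ hr, hlY _ hr, ?_⟩
      simp_rw [hqr]
      rw [MultMono.extIntegral_add (hlX _ hz) (hqX.lowerIntegrable hmX),
        MultMono.extIntegral_add (hlY _ hz) (hqY.lowerIntegrable hmY),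
        MultMono.extIntegral_eq_integral hmX hqX, MultMono.extIntegral_eq_integral hmY hqY, hqXY]
      exact add_le_add (h2 hmn).2.2 le_rfl
    · have h := (h3 t).2.2
      rw [MultMono.extIntegral_of_nonneg fun ω => MultMono.posPow_nonneg _ _,
        MultMono.extIntegral_of_nonneg fun ω => MultMono.posPow_nonneg _ _] at h
      exact EReal.coe_ennreal_le_coe_ennreal_iff.1 h
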